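/- Let $r\ge 2$. Let $B(\infty,\infty,r)$ be the group with generators $t_0,t_1,s_3,\dots,s_r$ and relations: the braid relations on the $s_j$ (that is, $s_is_j=s_js_i$ for $|i-j|\ge 2$ and $s_is_{i+1}s_i=s_{i+1}s_is_{i+1}$); $s_3t_is_3=t_is_3t_i$ for $i=0,1$; $s_jt_i=t_is_j$ for $i=0,1$ and $4\le j\le r$; and $s_3(t_1t_0)s_3(t_1t_0)=(t_1t_0)s_3(t_1t_0)s_3$. Let $B^+(\infty,\infty,r)$ be the monoid with generators $t_i$ ($i\in\mathbb Z$), $s_3,\dots,s_r$ and relations: the braid relations on the $s_j$; $t_it_{i-1}=t_jt_{j-1}$ for $i,j\in\mathbb Z$; $s_3t_is_3=t_is_3t_i$ for $i\in\mathbb Z$; and $s_jt_i=t_is_j$ for $i\in\mathbb Z$ and $4\le j\le r$. In this monoid let $$\Lambda=(s_rs_{r-1}\cdots s_3\,t_1t_0)^{r-1}.$$ A monoid $M$ is quasi-Garside with Garside element $\Delta\in M$ if (1) for every $m\in M$ the number of factors $\neq 1$ in a product equal to $m$ is bounded; (2) $M$ is left and right cancellative; (3) left divisibility and right divisibility are both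 lattice orders on $M$; (4) the set of left divisors of $\Delta$ equals the set of its right divisors ($\Delta$ is balanced), and this set generates $M$. Then the following hold. 1. $B^+(\infty,\infty,r)$ is a quasi-Garside monoid with Garside element $\Lambda$, and $B(\infty,\infty,r)$ is its group of fractions: there is an injective monoid homomorphism $B^+(\infty,\infty,r)\to B(\infty,\infty,r)$ sending $t_0,t_1,s_3,\dots,s_r$ to the generators of the same name, and every element of $B(\infty,\infty,r)$ can be written as $a^{-1}b$, and also as $ab^{-1}$, with $a,b$ in the image. 2. Let $B^+(\mathbf B_{r-1})$ be the monoid with generators $b_1,\dots,b_{r-1}$ and relations $b_ib_j=b_jb_i$ for $|i-j|>1$, $b_ib_{i+1}b_i=b_{i+1}b_ib_{i+1}$ for $1<i<r-1$, and (if $r\ge3$) $b_1b_2b_1b_2=b_2b_1b_2b_1$. Its element $\Delta_{\mathbf B_{r-1}}=(b_{r-1}b_{r-2}\cdots b_1)^{r-1}$ is the least common multiple of $b_1,\dots,b_{r-1}$ for left divisibility and for right divisibility. There is a monoid homomorphism $\psi:B^+(\mathbf B_{r-1})\to B^+(\infty,\infty,r)$ with $\psi(b_1)=t_1t_0$ and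 $\psi(b_i)=s_{i+1}$ for $2\le i\le r-1$, and $\psi(\Delta_{\mathbf B_{r-1}})=\Lambda$. 3. There is an automorphism $\tau$ of $B^+(\infty,\infty,r)$ with $\tau(t_i)=t_{i+1}$ for $i\in\mathbb Z$ and $\tau(s_j)=s_j$ for $3\le j\le r$, and $$\Lambda g=\tau^r(g)\Lambda\qquad\text{for all } g\in B^+(\infty,\infty,r).$$ -/

import Mathlib

/-! Quasi-Garside monoids and their groups of fractions. -/

namespace Garside

/-- `RightDvd a b`: `a` is a right divisor of `b`.  (Left divisibility is Mathlib's `a ∣ b`, which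
in a monoid means `∃ c, b = a * c`.) -/
def RightDvd {M : Type*} [Monoid M] (a b : M) : Prop := ∃ c, b = c * a

/-- The set of left divisors of `h`. -/
def leftDivisors {M : Type*} [Monoid M] (h : M) : Set M := {a | a ∣ h}

/-- The set of right divisors of `h`. -/
def rightDivisors {M : Type*} [Monoid M] (h : M) : Set M := {a | RightDvd a h}

/-- `M` is atomic: for each `m`, the number of factors (different from `1`) in a product equal
to `m` is bounded. -/
def IsAtomicMonoid (M : Type*) [Monoid M] : Prop :=
  ∀ m : M, ∃ N : ℕ, ∀ l : List M, (∀ x ∈ l, x ≠ 1) → l.prod = m → l.length ≤ N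

/-- `x` is a least upper bound of the set `S` for the relation `le`. -/
def IsLubFor {α : Type*} (le : α → α → Prop) (S : Set α) (x : α) : Prop :=
  (∀ a ∈ S, le a x) ∧ ∀ y, (∀ a ∈ S, le a y) → le x y

/-- `x` is a greatest lower bound of the set `S` for the relation `le`. -/
def IsGlbFor {α : Type*} (le : α → α → Prop) (S : Set α) (x : α) : Prop :=
  (∀ a ∈ S, le x a) ∧ ∀ y, (∀ a ∈ S, le y a) → le y x

/-- The relation `le` is a lattice order: a partial order in which any two elements have a
least upper bound and a greatest lower bound. -/
structure IsLatticeOrder {α : Type*} (le : α → α → Prop) : Prop where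
  refl : ∀ a, le a a
  trans : ∀ a b c, le a b → le b c → le a c
  antisymm : ∀ a b, le a b → le b a → a = b
  exists_lub : ∀ a b, ∃ x, IsLubFor le {a, b} x
  exists_glb : ∀ a b, ∃ x, IsGlbFor le {a, b} x

/-- `Δ` is a Garside element: its left divisors coincide with its right divisors
(it is balanced), and they generate the monoid. -/
structure IsGarsideElement {M : Type*} [Monoid M] (Δ : M) : Prop where
  balanced : leftDivisors Δ = rightDivisors Δ
  generates : Submonoid.closure (leftDivisors Δ) = ⊤

/-- `M` is a quasi-Garside monoid with Garside element `Δ`. -/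
structure IsQuasiGarside (M : Type*) [Monoid M] (Δ : M) : Prop where
  atomic : IsAtomicMonoid M
  left_cancel : ∀ a b c : M, a * b = a * c → b = c
  right_cancel : ∀ a b c : M, b * a = c * a → b = c
  left_lattice : IsLatticeOrder (fun a b : M => a ∣ b)
  right_lattice : IsLatticeOrder (fun a b : M => RightDvd a b)
  garside : IsGarsideElement Δ

/-- The homomorphism `ι` exhibits `G` as the group of fractions of `M`: it embeds `M` in `G`, and
every element of `G` is a left fraction and a right fraction of elements of `M`. -/
structure IsGroupOfFractions {M G : Type*} [Monoid M] [Group G] (ι : M →* G) : Prop where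
  injective : Function.Injective ι
  left_fraction : ∀ g : G, ∃ a b : M, g = (ι a)⁻¹ * ι b
  right_fraction : ∀ g : G, ∃ a b : M, g = ι a * (ι b)⁻¹

/-- `(M, Δ)` is a quasi-Garside structure on the group `G`, where `M` is mapped to `G` by `ι`. -/
structure IsQuasiGarsideStructure {M G : Type*} [Monoid M] [Group G] (ι : M →* G) (Δ : M) :
    Prop where
  quasiGarside : IsQuasiGarside M Δ
  fractions : IsGroupOfFractions ι

end Garside

namespace ImprimitiveBraid

/-! ### The braid group `B(∞,∞,r)`, by Shi's presentation -/

/-- The generators `t₀, t₁` and `s₃, …, s_r`. -/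
inductive ShiGen (r : ℕ) : Type
  | t (i : Fin 2) : ShiGen r
  | s (j : Set.Icc 3 r) : ShiGen r

open FreeGroup in
/-- The defining relations `u = v` of `B(∞,∞,r)`: the braid relations on the `s_j`
and the relations involving `t₀`, `t₁`. -/
inductive ShiRel (r : ℕ) : FreeGroup (ShiGen r) → FreeGroup (ShiGen r) → Prop
  | comm_s (i j : Set.Icc 3 r) (h : i.1 + 2 ≤ j.1) :
      ShiRel r (of (.s i) * of (.s j)) (of (.s j) * of (.s i))
  | braid_s (i j : Set.Icc 3 r) (h : i.1 + 1 = j.1) :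
      ShiRel r (of (.s i) * of (.s j) * of (.s i)) (of (.s j) * of (.s i) * of (.s j))
  | braid_t (i : Fin 2) (j : Set.Icc 3 r) (h : j.1 = 3) :
      ShiRel r (of (.s j) * of (.t i) * of (.s j)) (of (.t i) * of (.s j) * of (.t i))
  | comm_t (i : Fin 2) (j : Set.Icc 3 r) (h : 4 ≤ j.1) :
      ShiRel r (of (.s j) * of (.t i)) (of (.t i) * of (.s j))
  | double (j : Set.Icc 3 r) (h : j.1 = 3) :
      ShiRel r
        (of (.s j) * (of (.t 1) * of (.t 0)) * of (.s j) * (of (.t 1) * of (.t 0)))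
        ((of (.t 1) * of (.t 0)) * of (.s j) * (of (.t 1) * of (.t 0)) * of (.s j))

/-- The braid group `B(∞,∞,r)`. -/
abbrev BInf (r : ℕ) : Type :=
  PresentedGroup {w : FreeGroup (ShiGen r) | ∃ u v, ShiRel r u v ∧ w = u * v⁻¹}

/-- A generator of `B(∞,∞,r)`, as an element of the group. -/
def BInf.gen {r : ℕ} (x : ShiGen r) : BInf r := PresentedGroup.of x

/-! ### The monoid `B⁺(∞,∞,r)` of the positive presentation -/

/-- The generators `t_i` (`i ∈ ℤ`) and `s₃, …, s_r`. -/
inductive PosGen (r : ℕ) : Type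
  | t (i : ℤ) : PosGen r
  | s (j : Set.Icc 3 r) : PosGen r

open FreeMonoid in
/-- The defining relations of `B⁺(∞,∞,r)`: the braid relations on the `s_j`, all the products
`t_i t_{i-1}` are equal, `s₃ t_i s₃ = t_i s₃ t_i`, and `s_j t_i = t_i s_j` for `j ≥ 4`. -/
inductive PosRel (r : ℕ) : FreeMonoid (PosGen r) → FreeMonoid (PosGen r) → Prop
  | comm_s (i j : Set.Icc 3 r) (h : i.1 + 2 ≤ j.1) :
      PosRel r (of (.s i) * of (.s j)) (of (.s j) * of (.s i))
  | braid_s (i j : Set.Icc 3 r) (h : i.1 + 1 = j.1) :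
      PosRel r (of (.s i) * of (.s j) * of (.s i)) (of (.s j) * of (.s i) * of (.s j))
  | dual (i j : ℤ) :
      PosRel r (of (.t i) * of (.t (i - 1))) (of (.t j) * of (.t (j - 1)))
  | braid_t (i : ℤ) (j : Set.Icc 3 r) (h : j.1 = 3) :
      PosRel r (of (.s j) * of (.t i) * of (.s j)) (of (.t i) * of (.s j) * of (.t i))
  | comm_t (i : ℤ) (j : Set.Icc 3 r) (h : 4 ≤ j.1) :
      PosRel r (of (.s j) * of (.t i)) (of (.t i) * of (.s j))

/-- The monoid `B⁺(∞,∞,r)`. -/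
abbrev BInfPos (r : ℕ) : Type := PresentedMonoid (PosRel r)

/-- The generator `t_i` of `B⁺(∞,∞,r)`. -/
def BInfPos.t {r : ℕ} (i : ℤ) : BInfPos r := PresentedMonoid.of (PosRel r) (.t i)

/-- The generator `s_j` of `B⁺(∞,∞,r)`, where `3 ≤ j ≤ r`. -/
def BInfPos.s {r : ℕ} (j : Set.Icc 3 r) : BInfPos r := PresentedMonoid.of (PosRel r) (.s j)

/-- The element `A = s_r s_{r-1} ⋯ s₃`. -/
def BInfPos.A (r : ℕ) : BInfPos r :=
  (List.ofFn fun k : Fin (r - 2) =>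
    BInfPos.s (r := r) ⟨k.1 + 3, by have := k.2; constructor <;> omega⟩).reverse.prod

/-- The element `Λ = (s_r ⋯ s₃ t₁ t₀)^(r-1)`. -/
def BInfPos.Lam (r : ℕ) : BInfPos r :=
  (BInfPos.A r * BInfPos.t 1 * BInfPos.t 0) ^ (r - 1)

/-! ### The braid monoid of type `B_n` -/

open FreeMonoid in
/-- The defining relations of the braid monoid of type `B_n`, on generators `b₁, …, b_n`. -/
inductive TypeBRel (n : ℕ) : FreeMonoid (Set.Icc 1 n) → FreeMonoid (Set.Icc 1 n) → Prop
  | comm (i j : Set.Icc 1 n) (h : i.1 + 2 ≤ j.1) : TypeBRel n (of i * of j) (of j * of i)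
  | braid (i j : Set.Icc 1 n) (h₁ : 1 < i.1) (h : i.1 + 1 = j.1) :
      TypeBRel n (of i * of j * of i) (of j * of i * of j)
  | double (i j : Set.Icc 1 n) (h₁ : i.1 = 1) (h₂ : j.1 = 2) :
      TypeBRel n (of i * of j * of i * of j) (of j * of i * of j * of i)

/-- The braid monoid `B⁺(B_n)` of type `B_n`. -/
abbrev TypeBPos (n : ℕ) : Type := PresentedMonoid (TypeBRel n)

/-- The generator `b_i` of the braid monoid of type `B_n`, where `1 ≤ i ≤ n`. -/
def TypeBPos.b {n : ℕ} (i : Set.Icc 1 n) : TypeBPos n := PresentedMonoid.of (TypeBRel n) i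

/-- The element `(b_n b_{n-1} ⋯ b₁)^n`. -/
def TypeBPos.Delta (n : ℕ) : TypeBPos n :=
  (List.ofFn fun k : Fin n =>
    TypeBPos.b (n := n) ⟨k.1 + 1, by have := k.2; constructor <;> omega⟩).reverse.prod ^ n

/-- `x` is the least common multiple of the generators `b₁, …, b_n`, with respect to left
divisibility and also with respect to right divisibility; this is the property that
characterizes the classical Garside element of type `B_n`. -/
def TypeBPos.IsDelta {n : ℕ} (x : TypeBPos n) : Prop :=
  Garside.IsLubFor (fun a b => a ∣ b) (Set.range (TypeBPos.b (n := n))) x ∧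
    Garside.IsLubFor Garside.RightDvd (Set.range (TypeBPos.b (n := n))) x

end ImprimitiveBraid

/-! Both positive presentations are complemented: for each pair of distinct generators a, b there is
exactly one relation a C(a,b) = b C(b,a), with both sides of the same length. For such presentations
a cube condition on triples of generators implies that every common right-multiple of a and b is a
multiple of a C(a,b) (`IsComplemented.reduction`). Left cancellation is the case a = b. By induction
on length, any two elements with a common right-multiple have a least one. Checking the cubes is a
finite computation up to the shape of the triple: types A₃ and B₃, and the shapes with several t_i.

Lattices need common multiples, and these come from Λ. Put D = t₁t₀ and let Y_k = β_k ⋯ β₁ D β₁ ⋯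
β_k, where β_k = s_{k+2}. The elements D, s₃, …, s_r satisfy the type B relations, and these alone
give Λ = Y_{r-2} ⋯ Y₁ Y₀, which commutes with every s_j and is divisible by D and by every s_j.
Since D = t_i t_{i-1}, each t_i divides Λ as well. Moving t_i across D raises its index by 2, and
moving it across any other Y_k raises it by 1. So Λ moves past every element up to τ^r. Hence every
element divides a power of Λ, common multiples exist, and Λ is balanced. The anti-automorphism t_i ↦
t_{-i}, s_j ↦ s_j transfers cancellation and the lattice property to the other side.

By Ore's theorem the monoid embeds in some group. In B(∞,∞,r) the equations t_{i+1}t_i = D determine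
all t_i from t₀ and t₁, and the double relation carries the braid relation with s₃ from t₀, t₁ to
every t_i. This defines the map from the monoid to B(∞,∞,r). The Ore embedding factors through it,
so it is injective.

In type B, the same factorization of the power of the Coxeter element, together with the reduction
property, shows that it divides every common multiple of the generators (`typeB_jm_dvd`,
`typeB_cox_pow_dvd`). -/

namespace Garside

/-! ### Word reversing: cancellation and lcms from the cube condition. -/

section Complement

variable {α : Type*}

/-- The element of the presented monoid represented by the word `l`. -/
def ev (rel : FreeMonoid α → FreeMonoid α → Prop) (l : List α) : PresentedMonoid rel :=
  (l.map (PresentedMonoid.of rel)).prod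

/-- `Grid C u v p q`: word reversing with respect to the complement `C` computes the common
right-multiple `u p = v q` of the words `u` and `v`. -/
inductive Grid (C : α → α → List α) : List α → List α → List α → List α → Prop
  | nil_left (v : List α) : Grid C [] v v []
  | nil_right (u : List α) : Grid C u [] [] u
  | gen (a b : α) : Grid C [a] [b] (C a b) (C b a)
  | append_left {u₁ u₂ v p q p' q' : List α} :
      Grid C u₁ v p q → Grid C u₂ p p' q' → Grid C (u₁ ++ u₂) v p' (q ++ q')
  | append_right {u v₁ v₂ p q p' q' : List α} :
      Grid C u v₁ p q → Grid C q v₂ p' q' → Grid C u (v₁ ++ v₂) (p ++ p') q'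

/-- The cube condition for the triple `(a, b, c)`. -/
def Cube (rel : FreeMonoid α → FreeMonoid α → Prop) (C : α → α → List α) (a b c : α) : Prop :=
  ∃ v w z : List α, Grid C (C c a) (C c b) v w ∧
    ev rel (C a c) * ev rel v = ev rel (C a b) * ev rel z ∧
    ev rel (C b c) * ev rel w = ev rel (C b a) * ev rel z

/-- The relations `rel` are homogeneous, and they are the relations `a C(a,b) = b C(b,a)` for a
complement `C` that satisfies the cube condition. -/
structure IsComplemented (rel : FreeMonoid α → FreeMonoid α → Prop) (C : α → α → List α) :
    Prop where
  self : ∀ a, C a a = []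
  length_eq : ∀ a b, (C a b).length = (C b a).length
  rel_form : ∀ u v, rel u v → u = v ∨
    ∃ a b, u = FreeMonoid.ofList (a :: C a b) ∧ v = FreeMonoid.ofList (b :: C b a)
  ev_eq : ∀ a b, ev rel (a :: C a b) = ev rel (b :: C b a)
  cube : ∀ a b c, a ≠ b → a ≠ c → b ≠ c → Cube rel C a b c

variable {rel : FreeMonoid α → FreeMonoid α → Prop} {C : α → α → List α}

@[simp] theorem ev_nil : ev rel ([] : List α) = 1 := rfl

@[simp] theorem ev_cons (a : α) (l : List α) :
    ev rel (a :: l) = PresentedMonoid.of rel a * ev rel l := by simp [ev]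

@[simp] theorem ev_append (l l' : List α) : ev rel (l ++ l') = ev rel l * ev rel l' := by
  simp [ev]

theorem mk_ofList (l : List α) : PresentedMonoid.mk rel (FreeMonoid.ofList l) = ev rel l := by
  induction l with
  | nil => rfl
  | cons a l ih => rw [ev_cons, ← ih, FreeMonoid.ofList_cons, map_mul]; rfl

theorem exists_ev (m : PresentedMonoid rel) : ∃ l : List α, m = ev rel l := by
  obtain ⟨l, rfl⟩ := PresentedMonoid.surjective_mk m
  exact ⟨FreeMonoid.toList l, by rw [← mk_ofList]; rfl⟩

theorem ev_eq_ev_iff {l l' : List α} :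
    ev rel l = ev rel l' ↔ ConGen.Rel rel (FreeMonoid.ofList l) (FreeMonoid.ofList l') := by
  rw [← mk_ofList, ← mk_ofList, PresentedMonoid.mk_eq_mk_iff]; rfl

theorem eq_one_or_eq_of_mul (m : PresentedMonoid rel) :
    m = 1 ∨ ∃ a m', m = PresentedMonoid.of rel a * m' := by
  obtain ⟨l, rfl⟩ := exists_ev m
  cases l with
  | nil => exact .inl rfl
  | cons a l => exact .inr ⟨a, ev rel l, ev_cons a l⟩

theorem Grid.symm {u v p q : List α} (h : Grid C u v p q) : Grid C v u q p := by
  induction h with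
  | nil_left v => exact .nil_right v
  | nil_right u => exact .nil_left u
  | gen a b => exact .gen b a
  | append_left _ _ h₁ h₂ => exact .append_right h₁ h₂
  | append_right _ _ h₁ h₂ => exact .append_left h₁ h₂

theorem Cube.symm {a b c : α} (h : Cube rel C a b c) : Cube rel C b a c := by
  obtain ⟨v, w, z, h₁, h₂, h₃⟩ := h
  exact ⟨w, v, z, h₁.symm, h₃, h₂⟩

namespace IsComplemented

theorem length_rel (h : IsComplemented rel C) {u v : FreeMonoid α} (huv : rel u v) :
    u.toList.length = v.toList.length := by
  rcases h.rel_form u v huv with rfl | ⟨a, b, rfl, rfl⟩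
  · rfl
  · simp [h.length_eq a b]

/-- The length, as a homomorphism. -/
def lenHom (h : IsComplemented rel C) : PresentedMonoid rel →* Multiplicative ℕ :=
  PresentedMonoid.lift (fun _ => Multiplicative.ofAdd 1) fun u v huv => by
    have key : ∀ w : FreeMonoid α, FreeMonoid.lift (fun _ : α => Multiplicative.ofAdd 1) w =
        Multiplicative.ofAdd w.toList.length := fun w => by
      induction w with
      | one => rfl
      | of x => rfl
      | mul x y hx hy => rw [map_mul, hx, hy, ← ofAdd_add]; simp
    rw [key, key, h.length_rel huv]

/-- The length of the words that represent an element. -/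
def len (h : IsComplemented rel C) (m : PresentedMonoid rel) : ℕ := (h.lenHom m).toAdd

@[simp] theorem len_one (h : IsComplemented rel C) : h.len 1 = 0 := by simp [len]

@[simp] theorem len_mul (h : IsComplemented rel C) (m m' : PresentedMonoid rel) :
    h.len (m * m') = h.len m + h.len m' := by simp [len]

@[simp] theorem len_of (h : IsComplemented rel C) (a : α) :
    h.len (PresentedMonoid.of rel a) = 1 := rfl

@[simp] theorem len_ev (h : IsComplemented rel C) (l : List α) : h.len (ev rel l) = l.length := by
  induction l with
  | nil => simp
  | cons a l ih => simp [ih, add_comm]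

theorem eq_one_of_len (h : IsComplemented rel C) {m : PresentedMonoid rel} (hm : h.len m = 0) :
    m = 1 := by
  rcases eq_one_or_eq_of_mul m with rfl | ⟨a, m', rfl⟩
  · rfl
  · simp at hm

/-- The reduction property for common multiples of length less than `n`. -/
def ReductionBelow (h : IsComplemented rel C) (n : ℕ) : Prop :=
  ∀ (a b : α) (x y : PresentedMonoid rel),
    PresentedMonoid.of rel a * x = PresentedMonoid.of rel b * y →
    h.len (PresentedMonoid.of rel a * x) < n →
    ∃ z, x = ev rel (C a b) * z ∧ y = ev rel (C b a) * z

/-- A single cell of the grid is the reduction hypothesis itself; glued cells apply the property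
once for each cell. Thus every sufficiently short common multiple passes through the one that
reversing computes. -/
theorem grid_sound (h : IsComplemented rel C) {n : ℕ} (hn : h.ReductionBelow n)
    {u v p q : List α} (hg : Grid C u v p q) : ∀ x y : PresentedMonoid rel,
    ev rel u * x = ev rel v * y → h.len (ev rel u * x) < n →
    ∃ z, x = ev rel p * z ∧ y = ev rel q * z := by
  induction hg with
  | nil_left v => exact fun x y hxy _ => ⟨y, by simpa using hxy, by simp⟩
  | nil_right u => exact fun x y hxy _ => ⟨x, by simp, by simpa using hxy.symm⟩
  | gen a b =>
    intro x y hxy hl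
    exact hn a b x y (by simpa using hxy) (by simpa using hl)
  | append_left _ _ h₁ h₂ =>
    intro x y hxy hl
    obtain ⟨z, hz₁, hz₂⟩ := h₁ _ y (by simpa [mul_assoc] using hxy) (by simpa [mul_assoc] using hl)
    obtain ⟨z', hz₃, hz₄⟩ := h₂ x z hz₁ (by simp at hl ⊢; omega)
    exact ⟨z', hz₃, by simp [hz₂, hz₄, mul_assoc]⟩
  | append_right _ _ h₁ h₂ =>
    intro x y hxy hl
    obtain ⟨z, hz₁, hz₂⟩ := h₁ x _ (by simpa [mul_assoc] using hxy) hl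
    -- The length bound for the second cell is read off the right-hand side of `hxy`.
    have hl' := congrArg h.len hxy
    obtain ⟨z', hz₃, hz₄⟩ := h₂ z y hz₂.symm (by
      rw [← hz₂]; simp at hl hl' ⊢; omega)
    exact ⟨z', by simp [hz₁, hz₃, mul_assoc], hz₄⟩

/-- This makes reduction transitive: reductions from a to c and from c to b combine into one from a
to b. Soundness of the grid writes z₁, z₂ as v z', w z', and the cube condition then rewrites them.
When two of the letters coincide, only cancellation is needed. -/
theorem cube_sound (h : IsComplemented rel C) {n : ℕ} (hn : h.ReductionBelow n)
    (a b c : α) {z₁ z₂ : PresentedMonoid rel}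
    (hz : ev rel (C c a) * z₁ = ev rel (C c b) * z₂) (hl : h.len (ev rel (C c a) * z₁) < n) :
    ∃ z, ev rel (C a c) * z₁ = ev rel (C a b) * z ∧ ev rel (C b c) * z₂ = ev rel (C b a) * z := by
  have triv : ∀ w : List α, ev rel w * z₁ = ev rel w * z₂ → h.len (ev rel w * z₁) < n →
      z₁ = z₂ := fun w h₁ h₂ => by
    induction w with
    | nil => simpa using h₁
    | cons d w ih =>
      obtain ⟨z, hz₁, hz₂⟩ := hn d d (ev rel w * z₁) (ev rel w * z₂)
        (by simpa [mul_assoc] using h₁) (by simpa [mul_assoc] using h₂)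
      exact ih (by rw [hz₁, hz₂]) (by simp at h₂ ⊢; omega)
  by_cases hac : a = c
  · subst hac
    exact ⟨z₂, by simpa [h.self] using hz, rfl⟩
  by_cases hbc : b = c
  · subst hbc
    exact ⟨z₁, rfl, by simpa [h.self] using hz.symm⟩
  by_cases hab : a = b
  · subst hab
    obtain rfl := triv _ hz hl
    exact ⟨ev rel (C a c) * z₁, by simp [h.self], by simp [h.self]⟩
  obtain ⟨v, w, z, hg, h₁, h₂⟩ := h.cube a b c hab hac hbc
  obtain ⟨z', rfl, rfl⟩ := h.grid_sound hn hg z₁ z₂ hz hl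
  exact ⟨ev rel z * z', by rw [← mul_assoc, h₁, mul_assoc], by rw [← mul_assoc, h₂, mul_assoc]⟩

theorem length_eq_of_conGen (h : IsComplemented rel C) {w w' : FreeMonoid α}
    (hw : ConGen.Rel rel w w') : w.toList.length = w'.toList.length := by
  have := congrArg h.len (ev_eq_ev_iff (rel := rel) (l := w.toList) (l' := w'.toList) |>.2 hw)
  simpa using this

/-- Induction on a derivation of the equality of the two words. Only transitivity needs the cube
condition, applied at the first letter of the intermediate word. Removing that letter leaves length
below n, so the bound n on whole words suffices. -/
theorem reduction_words (h : IsComplemented rel C) {n : ℕ} (hn : h.ReductionBelow n)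
    {w w' : FreeMonoid α} (hw : ConGen.Rel rel w w') (hl : w.toList.length ≤ n) :
    ∀ (a b : α) (u u' : List α), w.toList = a :: u → w'.toList = b :: u' →
      ∃ z, ev rel u = ev rel (C a b) * z ∧ ev rel u' = ev rel (C b a) * z := by
  induction hw with
  | of x y hxy =>
    intro a b u u' hu hu'
    rcases h.rel_form x y hxy with rfl | ⟨a', b', rfl, rfl⟩
    · obtain ⟨rfl, rfl⟩ := List.cons_eq_cons.1 (hu.symm.trans hu')
      exact ⟨ev rel u, by simp [h.self]⟩
    · obtain ⟨rfl, rfl⟩ := List.cons_eq_cons.1 hu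
      obtain ⟨rfl, rfl⟩ := List.cons_eq_cons.1 hu'
      exact ⟨1, by simp⟩
  | refl x =>
    intro a b u u' hu hu'
    obtain ⟨rfl, rfl⟩ := List.cons_eq_cons.1 (hu.symm.trans hu')
    exact ⟨ev rel u, by simp [h.self]⟩
  | symm hxy ih =>
    intro a b u u' hu hu'
    obtain ⟨z, hz, hz'⟩ := ih (by rw [h.length_eq_of_conGen hxy]; exact hl) b a u' u hu' hu
    exact ⟨z, hz', hz⟩
  | @trans x y z hxy hyz ih₁ ih₂ =>
    intro a b u u' hu hu'
    have hl' := h.length_eq_of_conGen hxy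
    cases hy : y.toList with
    | nil => simp [hu, hy] at hl'
    | cons c t =>
      obtain ⟨z₁, h₁, h₂⟩ := ih₁ hl a c u t hu hy
      obtain ⟨z₂, h₃, h₄⟩ := ih₂ (hl' ▸ hl) c b t u' hy hu'
      rw [h₁, h₄]
      refine h.cube_sound hn a b c (h₂.symm.trans h₃) ?_
      rw [← h₂, len_ev]
      rw [hl', hy] at hl
      exact hl
  | @mul w x y z hwx hyz ih₁ ih₂ =>
    intro a b u u' hu hu'
    have hlw := h.length_eq_of_conGen hwx
    have hly := h.length_eq_of_conGen hyz
    rw [FreeMonoid.toList_mul] at hu hu' hl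
    rw [List.length_append] at hl
    -- The first letters sit in the left factors unless these are empty, and by homogeneity both
    -- left factors are empty together.
    cases hw : w.toList with
    | nil =>
      have hx : x.toList = [] := List.eq_nil_of_length_eq_zero (by rw [← hlw, hw]; rfl)
      exact ih₂ (by omega) a b u u' (by simpa [hw] using hu) (by simpa [hx] using hu')
    | cons c t =>
      cases hx : x.toList with
      | nil => simp [hw, hx] at hlw
      | cons d s =>
        rw [hw, List.cons_append] at hu
        rw [hx, List.cons_append] at hu'
        obtain ⟨rfl, rfl⟩ := List.cons_eq_cons.1 hu
        obtain ⟨rfl, rfl⟩ := List.cons_eq_cons.1 hu'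
        obtain ⟨z', h₁, h₂⟩ := ih₁ (by omega) c d t s hw hx
        have h₃ : ev rel y.toList = ev rel z.toList := ev_eq_ev_iff.2 hyz
        exact ⟨z' * ev rel y.toList, by rw [ev_append, h₁, mul_assoc],
          by rw [ev_append, h₂, h₃, mul_assoc]⟩

theorem reductionBelow (h : IsComplemented rel C) (n : ℕ) : h.ReductionBelow n := by
  induction n with
  | zero => exact fun _ _ _ _ _ hl => absurd hl (Nat.not_lt_zero _)
  | succ n ih =>
    intro a b x y hxy hl
    obtain ⟨u, rfl⟩ := exists_ev x
    obtain ⟨v, rfl⟩ := exists_ev y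
    rw [← ev_cons, ← ev_cons] at hxy
    rw [← ev_cons, len_ev] at hl
    exact h.reduction_words ih (ev_eq_ev_iff.1 hxy) (Nat.lt_succ_iff.1 hl) a b u v rfl rfl

/-- The reduction property: a common multiple of the generators `a` and `b` is a multiple of
`a C(a,b) = b C(b,a)`. -/
theorem reduction (h : IsComplemented rel C) {a b : α} {x y : PresentedMonoid rel}
    (hxy : PresentedMonoid.of rel a * x = PresentedMonoid.of rel b * y) :
    ∃ z, x = ev rel (C a b) * z ∧ y = ev rel (C b a) * z :=
  h.reductionBelow _ a b x y hxy (Nat.lt_succ_self _)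

theorem left_cancel (h : IsComplemented rel C) (m x y : PresentedMonoid rel)
    (hxy : m * x = m * y) : x = y := by
  obtain ⟨l, rfl⟩ := exists_ev m
  induction l with
  | nil => simpa using hxy
  | cons a l ih =>
    rw [ev_cons, mul_assoc, mul_assoc] at hxy
    obtain ⟨z, h₁, h₂⟩ := h.reduction hxy
    exact ih (by rw [h₁, h₂])

/-- For x = a x' and y = b y', every common multiple is a C(a,b) z. The lcms of C(a,b) with x' and
of C(b,a) with y' exist by induction and leave right factors p₁, p₂. The lcm sought is a C(a,b)
followed by the lcm of p₁ and p₂. -/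
theorem exists_lcm (h : IsComplemented rel C) (n : ℕ) : ∀ x y m : PresentedMonoid rel,
    h.len m ≤ n → x ∣ m → y ∣ m → ∃ l, IsLubFor (fun a b => a ∣ b) {x, y} l := by
  have lub_iff : ∀ x y l : PresentedMonoid rel, IsLubFor (fun a b => a ∣ b) {x, y} l ↔
      (x ∣ l ∧ y ∣ l) ∧ ∀ n, x ∣ n → y ∣ n → l ∣ n := by
    intro x y l; simp [IsLubFor]
  induction n with
  | zero =>
    rintro x y m hm ⟨c, rfl⟩ ⟨d, hd⟩
    have hm' := hm
    rw [hd] at hm'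
    simp only [len_mul] at hm hm'
    rw [h.eq_one_of_len (m := x) (by omega), h.eq_one_of_len (m := y) (by omega)]
    exact ⟨1, by simp [IsLubFor]⟩
  | succ n ih =>
    intro x y m hm hx hy
    rcases eq_one_or_eq_of_mul x with rfl | ⟨a, x', rfl⟩
    · exact ⟨y, (lub_iff _ _ _).2 ⟨⟨one_dvd _, dvd_rfl⟩, fun _ _ h => h⟩⟩
    rcases eq_one_or_eq_of_mul y with rfl | ⟨b, y', rfl⟩
    · exact ⟨_, (lub_iff _ _ _).2 ⟨⟨dvd_rfl, one_dvd _⟩, fun _ h _ => h⟩⟩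
    have split : ∀ k, PresentedMonoid.of rel a * x' ∣ k → PresentedMonoid.of rel b * y' ∣ k →
        ∃ z, k = PresentedMonoid.of rel a * (ev rel (C a b) * z) ∧
          x' ∣ ev rel (C a b) * z ∧ y' ∣ ev rel (C b a) * z := by
      rintro k ⟨c, rfl⟩ ⟨d, hd⟩
      rw [mul_assoc, mul_assoc] at hd
      obtain ⟨z, h₁, h₂⟩ := h.reduction hd
      exact ⟨z, by rw [← h₁, mul_assoc], h₁ ▸ dvd_mul_right _ _, h₂ ▸ dvd_mul_right _ _⟩
    have hC : (C a b).length = (C b a).length := h.length_eq a b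
    obtain ⟨z, rfl, h₁, h₂⟩ := split m hx hy
    simp only [len_mul, len_of, len_ev] at hm
    obtain ⟨l₁, hl₁⟩ := ih (ev rel (C a b)) x' (ev rel (C a b) * z) (by simp; omega)
      (dvd_mul_right _ _) h₁
    obtain ⟨l₂, hl₂⟩ := ih (ev rel (C b a)) y' (ev rel (C b a) * z) (by simp; omega)
      (dvd_mul_right _ _) h₂
    rw [lub_iff] at hl₁ hl₂
    obtain ⟨⟨⟨p₁, rfl⟩, hx'⟩, hl₁⟩ := hl₁
    obtain ⟨⟨⟨p₂, rfl⟩, hy'⟩, hl₂⟩ := hl₂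
    have hp : ∀ z, x' ∣ ev rel (C a b) * z → y' ∣ ev rel (C b a) * z → p₁ ∣ z ∧ p₂ ∣ z := by
      intro z hxz hyz
      obtain ⟨e, he⟩ := hl₁ _ (dvd_mul_right _ z) hxz
      obtain ⟨f, hf⟩ := hl₂ _ (dvd_mul_right _ z) hyz
      exact ⟨⟨e, h.left_cancel _ _ _ (by rw [he, mul_assoc])⟩,
        ⟨f, h.left_cancel _ _ _ (by rw [hf, mul_assoc])⟩⟩
    obtain ⟨l₃, hl₃⟩ := ih p₁ p₂ z (by omega) (hp z h₁ h₂).1 (hp z h₁ h₂).2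
    rw [lub_iff] at hl₃
    refine ⟨PresentedMonoid.of rel a * (ev rel (C a b) * l₃), (lub_iff _ _ _).2 ⟨⟨?_, ?_⟩, ?_⟩⟩
    · exact mul_dvd_mul_left _ (hx'.trans (mul_dvd_mul_left _ hl₃.1.1))
    · rw [← mul_assoc, ← ev_cons, h.ev_eq, ev_cons, mul_assoc]
      exact mul_dvd_mul_left _ (hy'.trans (mul_dvd_mul_left _ hl₃.1.2))
    · intro k hk₁ hk₂
      obtain ⟨z', rfl, h₃, h₄⟩ := split k hk₁ hk₂
      exact mul_dvd_mul_left _ (mul_dvd_mul_left _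
        (hl₃.2 z' (hp z' h₃ h₄).1 (hp z' h₃ h₄).2))

theorem isAtomicMonoid (h : IsComplemented rel C) : IsAtomicMonoid (PresentedMonoid rel) := by
  refine fun m => ⟨h.len m, fun l hl hm => hm ▸ ?_⟩
  clear hm
  induction l with
  | nil => simp
  | cons x l ih =>
    have hx : h.len x ≠ 0 := fun h0 => hl x (by simp) (h.eq_one_of_len h0)
    have := ih fun y hy => hl y (by simp [hy])
    simp only [List.length_cons, List.prod_cons, len_mul]
    omega

/-- If any two elements have a common right-multiple, left divisibility is a lattice order. -/
theorem isLatticeOrder (h : IsComplemented rel C)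
    (hm : ∀ x y : PresentedMonoid rel, ∃ m, x ∣ m ∧ y ∣ m) :
    IsLatticeOrder (fun a b : PresentedMonoid rel => a ∣ b) where
  refl := fun a => dvd_rfl
  trans := fun a b c => dvd_trans
  antisymm := by
    rintro a b ⟨c, rfl⟩ ⟨d, hd⟩
    have := congrArg h.len hd
    simp only [len_mul] at this
    rw [h.eq_one_of_len (m := c) (by omega), mul_one]
  exists_lub := fun a b => by
    obtain ⟨m, h₁, h₂⟩ := hm a b
    exact h.exists_lcm _ a b m le_rfl h₁ h₂
  exists_glb := fun a b => by
    classical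
    have hlen : ∀ {x y : PresentedMonoid rel}, x ∣ y → h.len x ≤ h.len y := by
      rintro x y ⟨c, rfl⟩; simp
    -- A common divisor d of maximal length is the gcd: for another common divisor e, the lcm of d
    -- and e still divides a and b, so it is no longer than d and equals d.
    let P : ℕ → Prop := fun n => ∃ d, d ∣ a ∧ d ∣ b ∧ h.len d = n
    have hP : P (Nat.findGreatest P (h.len a)) :=
      Nat.findGreatest_spec (m := 0) (Nat.zero_le _) ⟨1, one_dvd _, one_dvd _, by simp⟩
    obtain ⟨d, hda, hdb, hd⟩ := hP
    refine ⟨d, by simp [hda, hdb], fun e he => ?_⟩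
    have hea : e ∣ a := he a (by simp)
    have heb : e ∣ b := he b (by simp)
    obtain ⟨l, hl⟩ := h.exists_lcm _ d e a le_rfl hda hea
    have hdl : d ∣ l := hl.1 d (by simp)
    have hel : e ∣ l := hl.1 e (by simp)
    have hla : l ∣ a := hl.2 a (by simp [hda, hea])
    have hlb : l ∣ b := hl.2 b (by simp [hdb, heb])
    have hle : h.len l ≤ h.len d := hd ▸ Nat.le_findGreatest (hlen hla) ⟨l, hla, hlb, rfl⟩
    obtain ⟨c, rfl⟩ := hdl
    rw [len_mul] at hle
    rwa [h.eq_one_of_len (m := c) (by omega), mul_one] at hel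

end IsComplemented

end Complement

end Garside

namespace Garside

/-! ### Cube conditions for the possible shapes of triples. -/

section Cubes

variable {α : Type*} {rel : FreeMonoid α → FreeMonoid α → Prop} {C : α → α → List α}

theorem Grid.conv {u v p q p' q' : List α} (h : Grid C u v p q) (hp : p = p') (hq : q = q') :
    Grid C u v p' q' := hp ▸ hq ▸ h

theorem Grid.left {a : α} {u v p q p' q' : List α} (h₁ : Grid C [a] v p q) (h₂ : Grid C u p p' q') :
    Grid C (a :: u) v p' (q ++ q') := h₁.append_left h₂

theorem Grid.right {a b : α} {l l' v p' q' : List α} (h : C a b = l) (h' : C b a = l')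
    (h₂ : Grid C l' v p' q') : Grid C [a] (b :: v) (l ++ p') q' :=
  Grid.append_right (v₁ := [b]) (h ▸ h' ▸ .gen a b) h₂

theorem grid_comm {a : α} {l : List α} (hl : ∀ d ∈ l, C a d = [d] ∧ C d a = [a]) :
    Grid C [a] l l [a] := by
  induction l with
  | nil => exact .nil_right _
  | cons d l ih =>
    exact .right (hl d (by simp)).1 (hl d (by simp)).2 (ih fun e he => hl e (by simp [he]))

theorem of_mul_ev_comm {a : α} {l : List α} (hl : ∀ d ∈ l, PresentedMonoid.of rel a *
    PresentedMonoid.of rel d = PresentedMonoid.of rel d * PresentedMonoid.of rel a) :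
    PresentedMonoid.of rel a * ev rel l = ev rel l * PresentedMonoid.of rel a := by
  induction l with
  | nil => simp
  | cons d l ih =>
    rw [ev_cons, ← mul_assoc, hl d (by simp), mul_assoc, ih fun e he => hl e (by simp [he]),
      mul_assoc]

/-- The cube condition when `c` commutes with `a` and `b`. -/
theorem cube_of_comm_apex {a b c : α} (hca : C c a = [a]) (hcb : C c b = [b])
    (hac : C a c = [c]) (hbc : C b c = [c])
    (h₁ : PresentedMonoid.of rel c * ev rel (C a b) = ev rel (C a b) * PresentedMonoid.of rel c)
    (h₂ : PresentedMonoid.of rel c * ev rel (C b a) = ev rel (C b a) * PresentedMonoid.of rel c) :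
    Cube rel C a b c :=
  ⟨C a b, C b a, [c], by rw [hca, hcb]; exact .gen a b, by simpa [hac] using h₁,
    by simpa [hbc] using h₂⟩

/-- The cube condition when `a` commutes with `b` and `c`. -/
theorem cube_of_comm_left {a b c : α} (he : ∀ a b, ev rel (a :: C a b) = ev rel (b :: C b a))
    (hac : C a c = [c]) (hca : C c a = [a]) (hab : C a b = [b]) (hba : C b a = [a])
    (h₁ : ∀ d ∈ C c b, C a d = [d] ∧ C d a = [a])
    (h₂ : PresentedMonoid.of rel a * ev rel (C b c) = ev rel (C b c) * PresentedMonoid.of rel a) :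
    Cube rel C a b c :=
  ⟨C c b, [a], C b c, by rw [hca]; exact grid_comm h₁, by simpa [hac, hab] using he c b,
    by simpa [hba] using h₂.symm⟩

theorem ev_step (p : List α) {u v : List α} (h : ev rel u = ev rel v) (s : List α) :
    ev rel (p ++ u ++ s) = ev rel (p ++ v ++ s) := by simp only [ev_append, h]

theorem cube_of_ev_eq {a b c : α} {v w : List α} (z : List α) (hg : Grid C (C c a) (C c b) v w)
    (h₁ : ev rel (C a c ++ v) = ev rel (C a b ++ z))
    (h₂ : ev rel (C b c ++ w) = ev rel (C b a ++ z)) : Cube rel C a b c :=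
  ⟨v, w, z, hg, by simpa using h₁, by simpa using h₂⟩

/-- The relations are those of type A₃ with c in the middle. With a or b put in front, the words
compared represent the longest element, of length 6. -/
theorem cube_of_braid_apex {a b c : α} (he : ∀ a b, ev rel (a :: C a b) = ev rel (b :: C b a))
    (hc : C c c = []) (hac : C a c = [c, a]) (hca : C c a = [a, c])
    (hbc : C b c = [c, b]) (hcb : C c b = [b, c]) (hab : C a b = [b]) (hba : C b a = [a]) :
    Cube rel C a b c := by
  have h₁ := he a c
  have h₂ := he b c
  have h₃ := he a b
  rw [hac, hca] at h₁
  rw [hbc, hcb] at h₂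
  rw [hab, hba] at h₃
  refine cube_of_ev_eq (v := [b, c, a]) (w := [a, c, b]) [c, b, a, c] ?_ ?_ ?_
  · rw [hca, hcb]
    -- The output words are left open here: the grid is built by reversing letter by letter, and its
    -- outputs are then compared with the announced v and w.
    apply Grid.conv
    case h =>
      repeat' first | exact .nil_left _ | exact .nil_right _ | assumption |
        apply Grid.right | apply Grid.left
    all_goals rfl
  · rw [hac, hab]
    exact (ev_step [c] h₃ [c, a]) |>.trans (ev_step [c, b] h₁ []) |>.trans (ev_step [] h₂.symm [a, c])
  · rw [hbc, hba]
    exact (ev_step [c] h₃.symm [c, b]) |>.trans (ev_step [c, a] h₂ []) |>.trans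
        (ev_step [] h₁.symm [b, c]) |>.trans (ev_step [a, c] h₃ [c])

/-- Type A₃ again, now with a in the middle and c at an end. -/
theorem cube_of_braid_left {a b c : α} (he : ∀ a b, ev rel (a :: C a b) = ev rel (b :: C b a))
    (hac : C a c = [c, a]) (hca : C c a = [a, c])
    (hab : C a b = [b, a]) (hba : C b a = [a, b]) (hbc : C b c = [c]) (hcb : C c b = [b]) :
    Cube rel C a b c := by
  have h₁ := he a c
  have h₂ := he a b
  have h₃ := he b c
  rw [hac, hca] at h₁
  rw [hab, hba] at h₂
  rw [hbc, hcb] at h₃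
  refine cube_of_ev_eq (v := [b, a, c]) (w := [a, b, c, a]) [c, a, b] ?_ ?_ ?_
  · rw [hca, hcb]
    apply Grid.conv
    case h =>
      repeat' first | exact .nil_left _ | exact .nil_right _ | assumption |
        apply Grid.right | apply Grid.left
    all_goals rfl
  · rw [hac, hab]
    exact (ev_step [c] h₂ [c]) |>.trans (ev_step [c, b, a] h₃ []) |>.trans
        (ev_step [] h₃.symm [a, c, b]) |>.trans (ev_step [b] h₁.symm [b])
  · rw [hbc, hba]
    exact (ev_step [c, a] h₃ [a]) |>.trans (ev_step [] h₁.symm [b, a]) |>.trans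
        (ev_step [a, c] h₂ []) |>.trans (ev_step [a] h₃.symm [a, b])

section TypeB

variable {x y z : α} (he : ∀ a b, ev rel (a :: C a b) = ev rel (b :: C b a))
  (hxy : C x y = [y, x, y]) (hyx : C y x = [x, y, x])
  (hyz : C y z = [z, y]) (hzy : C z y = [y, z]) (hxz : C x z = [z]) (hzx : C z x = [x])

include he hxy hyx hyz hzy hxz hzx

/-- Here x, y, z satisfy the relations of type B₃, with x at the double bond. In this cube and the
next two, one for each choice of apex up to symmetry, the words compared have length 9 once the
first letter is put in front: they represent the longest element. -/
theorem cube_typeB_apex_one (hy : C y y = []) : Cube rel C y z x := by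
  have h₁ := he x y
  have h₂ := he y z
  have h₃ := he x z
  rw [hxy, hyx] at h₁
  rw [hyz, hzy] at h₂
  rw [hxz, hzx] at h₃
  refine cube_of_ev_eq (v := [z, y, x, y, z]) (w := [y, z, x, y, x, z, y])
    [x, y, x, z, y, x] ?_ ?_ ?_
  · rw [hxy, hxz]
    apply Grid.conv
    case h =>
      repeat' first | exact .nil_left _ | exact .nil_right _ | assumption |
        apply Grid.right | apply Grid.left
    all_goals rfl
  · rw [hyx, hyz]
    exact (ev_step [x, y] h₃ [y, x, y, z]) |>.trans (ev_step [x, y, z] h₁ [z]) |>.trans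
        (ev_step [x] h₂ [x, y, x, z]) |>.trans (ev_step [] h₃ [y, z, x, y, x, z]) |>.trans
        (ev_step [z, x, y, z, x, y] h₃ []) |>.trans (ev_step [z, x, y] h₃.symm [y, z, x]) |>.trans
        (ev_step [z, x, y, x] h₂.symm [x]) |>.trans (ev_step [z] h₁ [z, y, x])
  · rw [hzx, hzy]
    exact (ev_step [x, y, z, x, y] h₃ [y]) |>.trans (ev_step [x, y] h₃.symm [y, z, x, y]) |>.trans
        (ev_step [x, y, x] h₂.symm [x, y]) |>.trans (ev_step [] h₁ [z, y, x, y]) |>.trans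
        (ev_step [y, x, y] h₃ [y, x, y]) |>.trans (ev_step [y, x, y, z] h₁ []) |>.trans
        (ev_step [y, x] h₂ [x, y, x]) |>.trans (ev_step [y] h₃ [y, z, x, y, x]) |>.trans
        (ev_step [y, z, x, y] h₃.symm [y, x])

theorem cube_typeB_apex_two (hx : C x x = []) (hy : C y y = []) : Cube rel C x z y := by
  have h₁ := he x y
  have h₂ := he y z
  have h₃ := he x z
  rw [hxy, hyx] at h₁
  rw [hyz, hzy] at h₂
  rw [hxz, hzx] at h₃
  refine cube_of_ev_eq (v := [z, y, x, y, z]) (w := [x, y, x, z, y, x])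
    [y, z, x, y, x, z, y] ?_ ?_ ?_
  · rw [hyx, hyz]
    apply Grid.conv
    case h =>
      repeat' first | exact .nil_left _ | exact .nil_right _ | assumption |
        apply Grid.right | apply Grid.left
    all_goals rfl
  · rw [hxy, hxz]
    exact (ev_step [y, x] h₂ [x, y, z]) |>.trans (ev_step [y] h₃ [y, z, x, y, z]) |>.trans
        (ev_step [y, z, x, y] h₃.symm [y, z]) |>.trans (ev_step [y, z, x, y, x] h₂.symm []) |>.trans
        (ev_step [y, z] h₁ [z, y]) |>.trans (ev_step [] h₂ [x, y, x, z, y])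
  · rw [hzy, hzx]
    exact (ev_step [y, z, x, y] h₃ [y, x]) |>.trans (ev_step [y] h₃.symm [y, z, x, y, x]) |>.trans
        (ev_step [y, x] h₂.symm [x, y, x]) |>.trans (ev_step [y, x, y, z] h₁.symm []) |>.trans
        (ev_step [y, x, y] h₃.symm [y, x, y]) |>.trans (ev_step [] h₁.symm [z, y, x, y]) |>.trans
        (ev_step [x, y, x] h₂ [x, y]) |>.trans (ev_step [x, y] h₃ [y, z, x, y]) |>.trans
        (ev_step [x, y, z, x, y] h₃.symm [y])

theorem cube_typeB_apex_three : Cube rel C x y z := by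
  have h₁ := he x y
  have h₂ := he y z
  have h₃ := he x z
  rw [hxy, hyx] at h₁
  rw [hyz, hzy] at h₂
  rw [hxz, hzx] at h₃
  refine cube_of_ev_eq (v := [y, x, y, z, y, x, y]) (w := [x, y, z, x, y, x])
    [z, y, x, y, z] ?_ ?_ ?_
  · rw [hzx, hzy]
    apply Grid.conv
    case h =>
      repeat' first | exact .nil_left _ | exact .nil_right _ | assumption |
        apply Grid.right | apply Grid.left
    all_goals rfl
  · rw [hxz, hxy]
    exact (ev_step [z, y, x] h₂ [x, y]) |>.trans (ev_step [z, y] h₃ [y, z, x, y]) |>.trans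
        (ev_step [] h₂.symm [x, y, z, x, y]) |>.trans (ev_step [y, z, y, x, y] h₃.symm [y]) |>.trans
        (ev_step [y, z] h₁.symm [z, y]) |>.trans (ev_step [y, z, x, y, x] h₂ []) |>.trans
        (ev_step [y, z, x, y] h₃ [y, z]) |>.trans (ev_step [y] h₃.symm [y, z, x, y, z]) |>.trans
        (ev_step [y, x] h₂.symm [x, y, z])
  · rw [hyz, hyx]
    exact (ev_step [z, y, x, y] h₃.symm [y, x]) |>.trans (ev_step [z] h₁.symm [z, y, x]) |>.trans
        (ev_step [z, x, y, x] h₂ [x]) |>.trans (ev_step [z, x, y] h₃ [y, z, x]) |>.trans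
        (ev_step [] h₃.symm [y, z, x, y, z, x]) |>.trans (ev_step [x] h₂.symm [x, y, z, x]) |>.trans
        (ev_step [x, y, z, y, x, y] h₃.symm []) |>.trans (ev_step [x, y, z] h₁.symm [z]) |>.trans
        (ev_step [x, y] h₃.symm [y, x, y, z])

end TypeB

section Dual

variable {t : ℤ → α} {s : α} (he : ∀ a b, ev rel (a :: C a b) = ev rel (b :: C b a))
  (hC : ∀ a, C a a = [])
  (htt : ∀ i j, i ≠ j → C (t i) (t j) = [t (i - 1)])

-- The complements of t_i and t_j in t_k are the same letter, so reversing ends at once: t_i t_{i-1}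
-- is already the common multiple of all three.
include hC htt in
theorem cube_dual {i j k : ℤ} (hij : i ≠ j) (hik : i ≠ k) (hjk : j ≠ k) :
    Cube rel C (t i) (t j) (t k) := by
  refine cube_of_ev_eq (v := []) (w := []) [] ?_ ?_ ?_
  · rw [htt k i hik.symm, htt k j hjk.symm]
    have := Grid.gen (C := C) (t (k - 1)) (t (k - 1))
    rwa [hC] at this
  · rw [htt i k hik, htt i j hij]
  · rw [htt j k hjk, htt j i hij.symm]

include he htt in
theorem ev_dual (i j : ℤ) : ev rel [t i, t (i - 1)] = ev rel [t j, t (j - 1)] := by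
  rcases eq_or_ne i j with rfl | h
  · rfl
  · have := he (t i) (t j)
    rwa [htt i j h, htt j i h.symm] at this

variable (hts : ∀ i, C (t i) s = [s, t i]) (hst : ∀ i, C s (t i) = [t i, s])

include he hC htt hts hst

/-- With D the common value of the t_i t_{i-1}, the common multiple is D s D s. The rewriting
chooses the factorization of D that ends or begins with the letter needed for a braid relation. -/
theorem cube_dual_apex {i j : ℤ} (hij : i ≠ j) : Cube rel C (t i) (t j) s := by
  have hb : ∀ i, ev rel [s, t i, s] = ev rel [t i, s, t i] := fun i => by
    have := he s (t i)
    rwa [hts, hst] at this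
  have hd := ev_dual he htt
  have h₁ := htt _ _ hij
  have h₂ := htt _ _ hij.symm
  have h₃ := htt (i - 1) (j - 1) (by omega)
  have h₄ := htt (j - 1) (i - 1) (by omega)
  have hs := hC s
  have hi := hst (i - 1)
  have hj := hst (j - 1)
  have hi' := hts (i - 1)
  have hj' := hts (j - 1)
  refine cube_of_ev_eq (v := [t (i - 1), s, t (i - 1 - 1)]) (w := [t (j - 1), s, t (j - 1 - 1)])
    [s, t i, t (i - 1), s] ?_ ?_ ?_
  · rw [hst, hst]
    apply Grid.conv
    case h =>
      repeat' first | exact .nil_left _ | exact .nil_right _ | assumption |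
        apply Grid.right | apply Grid.left
    all_goals rfl
  · rw [hts, h₁]
    exact (ev_step [s] (hd i (i - 1)) [s, _]) |>.trans (ev_step [s, _] (hb _).symm []) |>.trans
      (ev_step [] (hb _) [_, s]) |>.trans (ev_step [_, s] (hd i (i - 1)).symm [s])
  · rw [hts, h₂]
    exact (ev_step [s] (hd j (j - 1)) [s, _]) |>.trans (ev_step [s, _] (hb _).symm []) |>.trans
      (ev_step [] (hb _) [_, s]) |>.trans (ev_step [_, s] (hd i (j - 1)).symm [s])

/-- The same common multiple D s D s, approached from the apex t_j. -/
theorem cube_dual_left {i j : ℤ} (hij : i ≠ j) : Cube rel C (t i) s (t j) := by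
  have hb : ∀ i, ev rel [s, t i, s] = ev rel [t i, s, t i] := fun i => by
    have := he s (t i)
    rwa [hts, hst] at this
  have hd := ev_dual he htt
  have h₁ := htt _ _ hij
  have h₂ := htt _ _ hij.symm
  have h₃ := htt j (j - 1) (by omega)
  have h₄ := htt (j - 1) j (by omega)
  have hs := hC s
  have hj := hst (j - 1)
  have hj' := hts (j - 1)
  have hk := hst (j - 1 - 1)
  have hk' := hts (j - 1 - 1)
  refine cube_of_ev_eq (v := [s, t (j - 1), t (j - 1 - 1), s]) (w := [t (j - 1), s, t (j - 1 - 1)])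
    [t (i - 1), s, t (i - 1 - 1)] ?_ ?_ ?_
  · rw [h₂, hts]
    apply Grid.conv
    case h =>
      repeat' first | exact .nil_left _ | exact .nil_right _ | assumption |
        apply Grid.right | apply Grid.left
    all_goals rfl
  · rw [h₁, hts]
    exact (ev_step [_, s] (hd (j - 1) (i - 1)) [s]) |>.trans
      (ev_step [] (hb _).symm [_, s]) |>.trans (ev_step [s, _] (hb _) []) |>.trans
      (ev_step [s] (hd i (i - 1)).symm [s, _])
  · rw [hst, hst]
    exact (ev_step [_] (hb _) [_]) |>.trans (ev_step [_, _, s] (hd (j - 1) i) []) |>.trans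
      (ev_step [] (hd j i) [s, _, _]) |>.trans (ev_step [_, _, s] (hd i (i - 1)) []) |>.trans
      (ev_step [_] (hb _).symm [_])

end Dual

end Cubes

end Garside

namespace ImprimitiveBraid

open Garside

/-! ### The presentation of `BInfPos r` is complemented. -/

section Positive

variable {r : ℕ}

/-- The node of the type `A` diagram at which a generator sits; all the `t i` share the node `2`. -/
def PosGen.level : PosGen r → ℕ
  | .t _ => 2
  | .s j => j.1

open Classical in
/-- The complement of the presentation of `B⁺(∞,∞,r)`. -/
noncomputable def posC (a b : PosGen r) : List (PosGen r) :=
  if a = b then [] else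
  if a.level = b.level then
    match a with
    | .t i => [.t (i - 1)]
    -- A value never used: distinct generators at the same node are both of the form t_i.
    | .s _ => []
  else if a.level + 1 = b.level ∨ b.level + 1 = a.level then [b, a] else [b]

theorem posC_self (a : PosGen r) : posC a a = [] := by simp [posC]

theorem PosGen.two_le_level (a : PosGen r) : 2 ≤ a.level := by
  cases a with
  | t i => exact le_rfl
  | s j => have := j.2.1; simp only [PosGen.level]; omega

theorem PosGen.exists_t {a b : PosGen r} (hab : a ≠ b) (h : a.level = b.level) :
    ∃ i j, a = .t i ∧ b = .t j ∧ i ≠ j := by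
  cases a with
  | t i =>
    cases b with
    | t j => exact ⟨i, j, rfl, rfl, fun h => hab (h ▸ rfl)⟩
    | s j => have := j.2.1; simp only [PosGen.level] at h; omega
  | s i =>
    cases b with
    | t j => have := i.2.1; simp only [PosGen.level] at h; omega
    | s j => exact absurd (congrArg PosGen.s (Subtype.ext h)) hab

theorem PosGen.exists_t_of_level {a : PosGen r} (h : a.level = 2) : ∃ i, a = .t i := by
  cases a with
  | t i => exact ⟨i, rfl⟩
  | s j => have := j.2.1; simp only [PosGen.level] at h; omega

theorem posC_t {i j : ℤ} (h : i ≠ j) : posC (r := r) (.t i) (.t j) = [.t (i - 1)] := by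
  simp [posC, h, PosGen.level]

theorem posC_adj {a b : PosGen r} (h : a.level + 1 = b.level ∨ b.level + 1 = a.level) :
    posC a b = [b, a] := by
  have h₁ : a ≠ b := by rintro rfl; omega
  unfold posC
  rw [if_neg h₁, if_neg (by omega), if_pos h]

/-- The nodes of two generators are neither equal nor adjacent. -/
def PosGen.Far (a b : PosGen r) : Prop := a.level + 2 ≤ b.level ∨ b.level + 2 ≤ a.level

theorem PosGen.Far.symm {a b : PosGen r} (h : a.Far b) : b.Far a := Or.symm h

theorem posC_far {a b : PosGen r} (h : a.Far b) : posC a b = [b] := by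
  unfold PosGen.Far at h
  have h₁ : a ≠ b := by rintro rfl; omega
  unfold posC
  rw [if_neg h₁, if_neg (by omega), if_neg (by omega)]

/-- No new nodes appear in a complement, so a generator far from a and b commutes with all of
C(a,b). -/
theorem level_of_mem_posC {a b d : PosGen r} (h : d ∈ posC a b) :
    d.level = a.level ∨ d.level = b.level := by
  by_cases hab : a = b
  · simp [hab, posC_self] at h
  by_cases hl : a.level = b.level
  · obtain ⟨i, j, rfl, rfl, hij⟩ := PosGen.exists_t hab hl
    simp only [posC_t hij, List.mem_singleton] at h
    subst h
    exact .inl rfl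
  by_cases hadj : a.level + 1 = b.level ∨ b.level + 1 = a.level
  · simp only [posC_adj hadj, List.mem_cons, List.not_mem_nil, or_false] at h
    rcases h with rfl | rfl <;> simp
  · rw [posC_far (by unfold PosGen.Far; omega)] at h
    simp at h
    simp [h]

theorem ev_posC (a b : PosGen r) : ev (PosRel r) (a :: posC a b) = ev (PosRel r) (b :: posC b a) := by
  have of_rel : ∀ {u v : List (PosGen r)}, PosRel r (FreeMonoid.ofList u) (FreeMonoid.ofList v) →
      ev (PosRel r) u = ev (PosRel r) v := fun h => ev_eq_ev_iff.2 (.of _ _ h)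
  have key : ∀ a b : PosGen r, a.level ≤ b.level →
      ev (PosRel r) (a :: posC a b) = ev (PosRel r) (b :: posC b a) := by
    intro a b hle
    by_cases hab : a = b
    · rw [hab]
    rcases hle.eq_or_lt with hl | hl
    · obtain ⟨i, j, rfl, rfl, hij⟩ := PosGen.exists_t hab hl
      rw [posC_t hij, posC_t hij.symm]
      exact of_rel (PosRel.dual i j)
    have hb : ∃ j, b = .s j := by
      cases b with
      | t i => exact absurd hl (not_lt.2 a.two_le_level)
      | s j => exact ⟨j, rfl⟩
    obtain ⟨j, rfl⟩ := hb
    rcases (Nat.succ_le_of_lt hl).eq_or_lt with hl' | hl'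
    · rw [posC_adj (.inl hl'), posC_adj (.inr hl')]
      cases a with
      | t i => exact (of_rel (PosRel.braid_t i j hl'.symm)).symm
      | s i => exact of_rel (PosRel.braid_s i j hl')
    · rw [posC_far (.inl hl'), posC_far (.inr hl')]
      cases a with
      | t i => exact (of_rel (PosRel.comm_t i j hl')).symm
      | s i => exact of_rel (PosRel.comm_s i j hl')
  rcases le_total a.level b.level with h | h
  · exact key a b h
  · exact (key b a h).symm

theorem PosGen.Far.comm {a b : PosGen r} (h : a.Far b) :
    PresentedMonoid.of (PosRel r) a * PresentedMonoid.of (PosRel r) b =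
      PresentedMonoid.of (PosRel r) b * PresentedMonoid.of (PosRel r) a := by
  simpa [posC_far h, posC_far h.symm] using ev_posC a b

theorem PosGen.Far.comm_ev {a b c : PosGen r} (h₁ : c.Far a) (h₂ : c.Far b) :
    PresentedMonoid.of (PosRel r) c * ev (PosRel r) (posC a b) =
      ev (PosRel r) (posC a b) * PresentedMonoid.of (PosRel r) c :=
  of_mul_ev_comm fun d hd => by
    refine PosGen.Far.comm ?_
    unfold PosGen.Far at *
    rcases level_of_mem_posC hd with h | h <;> rwa [h]

theorem pos_cube {a b c : PosGen r} (hab : a ≠ b) (hac : a ≠ c) (hbc : b ≠ c) :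
    Cube (PosRel r) posC a b c := by
  have left : ∀ {a b : PosGen r}, a.Far b → a.Far c → Cube (PosRel r) posC a b c :=
    fun {a b} h₁ h₂ => cube_of_comm_left ev_posC (posC_far h₂) (posC_far h₂.symm) (posC_far h₁)
      (posC_far h₁.symm) (fun d hd => by
        have hd' : a.Far d := by
          unfold PosGen.Far at *
          rcases level_of_mem_posC hd with h | h <;> rwa [h]
        exact ⟨posC_far hd', posC_far hd'.symm⟩) (h₁.comm_ev h₂)
  by_cases h₁ : c.Far a
  · by_cases h₂ : c.Far b
    · exact cube_of_comm_apex (posC_far h₁) (posC_far h₂) (posC_far h₁.symm) (posC_far h₂.symm)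
        (h₁.comm_ev h₂) (h₂.comm_ev h₁)
    by_cases h₃ : a.Far b
    · exact left h₃ h₁.symm
    have h₁' := h₁
    rw [PosGen.Far] at h₁' h₂ h₃
    exact (cube_of_braid_left ev_posC (posC_adj (by omega)) (posC_adj (by omega))
      (posC_adj (by omega)) (posC_adj (by omega)) (posC_far h₁.symm) (posC_far h₁)).symm
  by_cases h₂ : c.Far b
  · by_cases h₃ : a.Far b
    · exact (left h₃.symm h₂.symm).symm
    rw [PosGen.Far] at h₁ h₃
    have h₂' := h₂
    rw [PosGen.Far] at h₂'
    exact cube_of_braid_left ev_posC (posC_adj (by omega)) (posC_adj (by omega))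
      (posC_adj (by omega)) (posC_adj (by omega)) (posC_far h₂.symm) (posC_far h₂)
  by_cases h₃ : a.Far b
  · rw [PosGen.Far] at h₁ h₂
    have h₃' := h₃
    rw [PosGen.Far] at h₃'
    exact cube_of_braid_apex ev_posC (posC_self c) (posC_adj (by omega)) (posC_adj (by omega))
      (posC_adj (by omega)) (posC_adj (by omega)) (posC_far h₃) (posC_far h₃.symm)
  -- No two nodes are far apart now, so at least two of the three coincide. Those two generators are
  -- then t's, and only the shapes with several t_i remain.
  rw [PosGen.Far] at h₁ h₂ h₃
  have htt : ∀ i j : ℤ, i ≠ j → posC (r := r) (.t i) (.t j) = [.t (i - 1)] := fun i j => posC_t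
  have hl : ∀ i : ℤ, (PosGen.t (r := r) i).level = 2 := fun i => rfl
  have dual_left : ∀ {a b : PosGen r}, a ≠ c → a.level = c.level → b.level ≠ c.level →
      ¬ b.Far c → Cube (PosRel r) posC a b c := by
    intro a b h h' hb hf
    obtain ⟨i, k, rfl, rfl, hik⟩ := PosGen.exists_t h h'
    have := b.two_le_level
    rw [PosGen.Far, hl] at hf
    rw [hl] at hb
    exact cube_dual_left ev_posC posC_self htt (fun i => posC_adj (by rw [hl]; omega))
      (fun i => posC_adj (by rw [hl]; omega)) hik
  by_cases hca : a.level = c.level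
  · by_cases hcb : b.level = c.level
    · obtain ⟨i, j, rfl, rfl, hij⟩ := PosGen.exists_t hab (hca.trans hcb.symm)
      obtain ⟨k, rfl⟩ := PosGen.exists_t_of_level hca.symm
      exact cube_dual posC_self htt hij (fun h => hac (h ▸ rfl)) (fun h => hbc (h ▸ rfl))
    · exact dual_left hac hca hcb (by rw [PosGen.Far]; omega)
  · by_cases hcb : b.level = c.level
    · exact (dual_left hbc hcb hca (by rw [PosGen.Far]; omega)).symm
    have hlab : a.level = b.level := by
      by_contra hne
      omega
    obtain ⟨i, j, rfl, rfl, hij⟩ := PosGen.exists_t hab hlab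
    have := c.two_le_level
    rw [hl] at *
    exact cube_dual_apex ev_posC posC_self htt (fun i => posC_adj (by rw [hl]; omega))
      (fun i => posC_adj (by rw [hl]; omega)) hij

theorem pos_isComplemented (r : ℕ) : IsComplemented (PosRel r) posC where
  self := posC_self
  length_eq := fun a b => by
    by_cases hab : a = b
    · rw [hab]
    by_cases hl : a.level = b.level
    · obtain ⟨i, j, rfl, rfl, hij⟩ := PosGen.exists_t hab hl
      rw [posC_t hij, posC_t hij.symm]; rfl
    by_cases hadj : a.level + 1 = b.level ∨ b.level + 1 = a.level
    · rw [posC_adj hadj, posC_adj hadj.symm]; rfl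
    · have h : a.Far b := by unfold PosGen.Far; omega
      rw [posC_far h, posC_far h.symm]; rfl
  rel_form := fun u v h => by
    cases h with
    | comm_s i j h =>
      have hf : (PosGen.s i).Far (.s j) := .inl h
      exact .inr ⟨.s i, .s j, by rw [posC_far hf]; rfl, by rw [posC_far hf.symm]; rfl⟩
    | braid_s i j h =>
      have ha : (PosGen.s i).level + 1 = (PosGen.s j).level := h
      exact .inr ⟨.s i, .s j, by rw [posC_adj (.inl ha)]; rfl, by rw [posC_adj (.inr ha)]; rfl⟩
    | dual i j =>
      rcases eq_or_ne i j with rfl | hij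
      · exact .inl rfl
      · exact .inr ⟨.t i, .t j, by rw [posC_t hij]; rfl, by rw [posC_t hij.symm]; rfl⟩
    | braid_t i j h =>
      have ha : (PosGen.t (r := r) i).level + 1 = (PosGen.s j).level := h.symm
      exact .inr ⟨.s j, .t i, by rw [posC_adj (.inr ha)]; rfl, by rw [posC_adj (.inl ha)]; rfl⟩
    | comm_t i j h =>
      have hf : (PosGen.s j).Far (.t i) := .inr h
      exact .inr ⟨.s j, .t i, by rw [posC_far hf]; rfl, by rw [posC_far hf.symm]; rfl⟩
  ev_eq := ev_posC
  cube := fun _ _ _ => pos_cube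

end Positive

/-! ### The presentation of the type B braid monoid is complemented. -/

section TypeB

variable {n : ℕ}

/-- The complement of the presentation of the braid monoid of type `B_n`. -/
def typeBC (a b : Set.Icc 1 n) : List (Set.Icc 1 n) :=
  if a = b then [] else
  if a.1 + 1 = b.1 ∨ b.1 + 1 = a.1 then
    if a.1 = 1 ∨ b.1 = 1 then [b, a, b] else [b, a]
  else [b]

theorem typeBC_self (a : Set.Icc 1 n) : typeBC a a = [] := by simp [typeBC]

theorem typeBC_double {a b : Set.Icc 1 n} (h : a.1 = 1 ∧ b.1 = 2 ∨ a.1 = 2 ∧ b.1 = 1) :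
    typeBC a b = [b, a, b] := by
  rw [typeBC, if_neg (by rintro rfl; omega), if_pos (by omega), if_pos (by omega)]

theorem typeBC_adj {a b : Set.Icc 1 n} (h : a.1 + 1 = b.1 ∨ b.1 + 1 = a.1) (ha : 1 < a.1)
    (hb : 1 < b.1) : typeBC a b = [b, a] := by
  rw [typeBC, if_neg (by rintro rfl; omega), if_pos h, if_neg (by omega)]

theorem typeBC_far {a b : Set.Icc 1 n} (h : a.1 + 2 ≤ b.1 ∨ b.1 + 2 ≤ a.1) :
    typeBC a b = [b] := by
  rw [typeBC, if_neg (by rintro rfl; omega), if_neg (by omega)]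

theorem mem_typeBC {a b d : Set.Icc 1 n} (h : d ∈ typeBC a b) : d = a ∨ d = b := by
  unfold typeBC at h
  split_ifs at h <;> simp at h <;> tauto

theorem ev_typeBC (a b : Set.Icc 1 n) :
    ev (TypeBRel n) (a :: typeBC a b) = ev (TypeBRel n) (b :: typeBC b a) := by
  have of_rel : ∀ {u v : List (Set.Icc 1 n)},
      TypeBRel n (FreeMonoid.ofList u) (FreeMonoid.ofList v) →
      ev (TypeBRel n) u = ev (TypeBRel n) v := fun h => ev_eq_ev_iff.2 (.of _ _ h)
  have key : ∀ a b : Set.Icc 1 n, a.1 ≤ b.1 →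
      ev (TypeBRel n) (a :: typeBC a b) = ev (TypeBRel n) (b :: typeBC b a) := by
    intro a b hle
    have ha := a.2.1
    by_cases hab : a = b
    · rw [hab]
    have hne : a.1 ≠ b.1 := fun h => hab (Subtype.ext h)
    by_cases h1 : a.1 = 1 ∧ b.1 = 2
    · rw [typeBC_double (.inl h1), typeBC_double (.inr h1.symm)]
      exact of_rel (TypeBRel.double a b h1.1 h1.2)
    by_cases hadj : a.1 + 1 = b.1
    · rw [typeBC_adj (by omega) (by omega) (by omega),
        typeBC_adj (by omega) (by omega) (by omega)]
      exact of_rel (TypeBRel.braid a b (by omega) hadj)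
    · rw [typeBC_far (by omega), typeBC_far (by omega)]
      exact of_rel (TypeBRel.comm a b (by omega))
  rcases le_total a.1 b.1 with h | h
  · exact key a b h
  · exact (key b a h).symm

theorem typeB_comm_of {a b : Set.Icc 1 n} (h : a.1 + 2 ≤ b.1 ∨ b.1 + 2 ≤ a.1) :
    PresentedMonoid.of (TypeBRel n) a * PresentedMonoid.of (TypeBRel n) b =
      PresentedMonoid.of (TypeBRel n) b * PresentedMonoid.of (TypeBRel n) a := by
  simpa [typeBC_far h, typeBC_far h.symm] using ev_typeBC a b

theorem typeB_cube {a b c : Set.Icc 1 n} (hab : a ≠ b) (hac : a ≠ c) (hbc : b ≠ c) :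
    Cube (TypeBRel n) typeBC a b c := by
  have comm_ev : ∀ {a b c : Set.Icc 1 n}, c.1 + 2 ≤ a.1 ∨ a.1 + 2 ≤ c.1 →
      c.1 + 2 ≤ b.1 ∨ b.1 + 2 ≤ c.1 → PresentedMonoid.of (TypeBRel n) c *
      ev (TypeBRel n) (typeBC a b) = ev (TypeBRel n) (typeBC a b) * PresentedMonoid.of _ c :=
    fun h₁ h₂ => of_mul_ev_comm fun d hd => typeB_comm_of (by
      rcases mem_typeBC hd with rfl | rfl <;> assumption)
  have left : ∀ {a b : Set.Icc 1 n}, a.1 + 2 ≤ b.1 ∨ b.1 + 2 ≤ a.1 →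
      a.1 + 2 ≤ c.1 ∨ c.1 + 2 ≤ a.1 → Cube (TypeBRel n) typeBC a b c :=
    fun h₁ h₂ => cube_of_comm_left ev_typeBC (typeBC_far h₂) (typeBC_far h₂.symm) (typeBC_far h₁)
      (typeBC_far h₁.symm) (fun d hd => by
        rcases mem_typeBC hd with rfl | rfl
        · exact ⟨typeBC_far h₂, typeBC_far h₂.symm⟩
        · exact ⟨typeBC_far h₁, typeBC_far h₁.symm⟩) (comm_ev h₁ h₂)
  have ha := a.2.1
  have hb := b.2.1
  have hc := c.2.1
  have hab' : a.1 ≠ b.1 := fun h => hab (Subtype.ext h)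
  have hac' : a.1 ≠ c.1 := fun h => hac (Subtype.ext h)
  have hbc' : b.1 ≠ c.1 := fun h => hbc (Subtype.ext h)
  -- `c` is at an end of the segment formed by the three nodes, and `a` is in the middle
  have end_case : ∀ {a b : Set.Icc 1 n}, 1 ≤ a.1 → 1 ≤ b.1 →
      (a.1 + 1 = c.1 ∨ c.1 + 1 = a.1) → (a.1 + 1 = b.1 ∨ b.1 + 1 = a.1) →
      b.1 ≠ c.1 → Cube (TypeBRel n) typeBC a b c := by
    intro a b ha hb h₁ h₂ h₃
    by_cases hc1 : c.1 = 1
    · exact cube_typeB_apex_one ev_typeBC (typeBC_double (by omega)) (typeBC_double (by omega))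
        (typeBC_adj (by omega) (by omega) (by omega)) (typeBC_adj (by omega) (by omega) (by omega))
        (typeBC_far (by omega)) (typeBC_far (by omega)) (typeBC_self a)
    by_cases hb1 : b.1 = 1
    · exact (cube_typeB_apex_three ev_typeBC (typeBC_double (by omega)) (typeBC_double (by omega))
        (typeBC_adj (by omega) (by omega) (by omega)) (typeBC_adj (by omega) (by omega) (by omega))
        (typeBC_far (by omega)) (typeBC_far (by omega))).symm
    exact cube_of_braid_left ev_typeBC
        (typeBC_adj (by omega) (by omega) (by omega)) (typeBC_adj (by omega) (by omega) (by omega))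
        (typeBC_adj (by omega) (by omega) (by omega)) (typeBC_adj (by omega) (by omega) (by omega))
        (typeBC_far (by omega)) (typeBC_far (by omega))
  by_cases h₁ : c.1 + 2 ≤ a.1 ∨ a.1 + 2 ≤ c.1
  · by_cases h₂ : c.1 + 2 ≤ b.1 ∨ b.1 + 2 ≤ c.1
    · exact cube_of_comm_apex (typeBC_far h₁) (typeBC_far h₂) (typeBC_far h₁.symm)
        (typeBC_far h₂.symm) (comm_ev h₁ h₂) (comm_ev h₂ h₁)
    by_cases h₃ : a.1 + 2 ≤ b.1 ∨ b.1 + 2 ≤ a.1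
    · exact left h₃ h₁.symm
    exact (end_case hb ha (by omega) (by omega) hac').symm
  by_cases h₂ : c.1 + 2 ≤ b.1 ∨ b.1 + 2 ≤ c.1
  · by_cases h₃ : a.1 + 2 ≤ b.1 ∨ b.1 + 2 ≤ a.1
    · exact (left h₃.symm h₂.symm).symm
    exact end_case ha hb (by omega) (by omega) hbc'
  have mid : ∀ {a b : Set.Icc 1 n}, 1 ≤ a.1 → a.1 + 1 = c.1 → c.1 + 1 = b.1 →
      Cube (TypeBRel n) typeBC a b c := by
    intro a b ha hac hcb
    by_cases ha1 : a.1 = 1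
    · exact cube_typeB_apex_two ev_typeBC (typeBC_double (by omega)) (typeBC_double (by omega))
        (typeBC_adj (by omega) (by omega) (by omega)) (typeBC_adj (by omega) (by omega) (by omega))
        (typeBC_far (by omega)) (typeBC_far (by omega)) (typeBC_self a) (typeBC_self c)
    exact cube_of_braid_apex ev_typeBC (typeBC_self c)
        (typeBC_adj (by omega) (by omega) (by omega)) (typeBC_adj (by omega) (by omega) (by omega))
        (typeBC_adj (by omega) (by omega) (by omega)) (typeBC_adj (by omega) (by omega) (by omega))
        (typeBC_far (by omega)) (typeBC_far (by omega))
  rcases lt_or_gt_of_ne hab' with h | h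
  · exact mid ha (by omega) (by omega)
  · exact (mid hb (by omega) (by omega)).symm

theorem typeB_isComplemented (n : ℕ) : IsComplemented (TypeBRel n) typeBC where
  self := typeBC_self
  length_eq := fun a b => by
    simp only [typeBC, eq_comm (a := b), or_comm (a := b.1 + 1 = a.1), or_comm (a := b.1 = 1)]
    split_ifs <;> rfl
  rel_form := fun u v h => .inr <| by
    cases h with
    | comm i j h =>
      exact ⟨i, j, by rw [typeBC_far (.inl h)]; rfl, by rw [typeBC_far (.inr h)]; rfl⟩
    | braid i j h₁ h =>
      exact ⟨i, j, by rw [typeBC_adj (.inl h) h₁ (by omega)]; rfl,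
        by rw [typeBC_adj (.inr h) (by omega) h₁]; rfl⟩
    | double i j h₁ h₂ =>
      exact ⟨i, j, by rw [typeBC_double (.inl ⟨h₁, h₂⟩)]; rfl,
        by rw [typeBC_double (.inr ⟨h₂, h₁⟩)]; rfl⟩
  ev_eq := ev_typeBC
  cube := fun _ _ _ => typeB_cube

end TypeB

end ImprimitiveBraid

/-! ### Powers of the Coxeter element from the type B relations. -/

namespace ImprimitiveBraid

open Garside

/-- Elements `β 0, …, β (n - 1)` of a monoid that satisfy the relations of the braid monoid of
type `B_n`. -/
structure TypeBFamily {M : Type*} [Monoid M] (n : ℕ) (β : ℕ → M) : Prop where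
  comm : ∀ i j, i + 2 ≤ j → j < n → β i * β j = β j * β i
  braid : ∀ i, 1 ≤ i → i + 1 < n → β i * β (i + 1) * β i = β (i + 1) * β i * β (i + 1)
  double : 1 < n → β 0 * β 1 * β 0 * β 1 = β 1 * β 0 * β 1 * β 0

section Family

variable {M : Type*} [Monoid M]

/-- The Jucys–Murphy type element `β k ⋯ β 1 β 0 β 1 ⋯ β k`. -/
def jm (β : ℕ → M) : ℕ → M
  | 0 => β 0
  | k + 1 => β (k + 1) * jm β k * β (k + 1)

/-- The Coxeter element `β (k - 1) ⋯ β 0`. -/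
def cox (β : ℕ → M) : ℕ → M
  | 0 => 1
  | k + 1 => β k * cox β k

/-- The product `β a β (a + 1) ⋯ β (a + l - 1)`. -/
def up (β : ℕ → M) (a : ℕ) : ℕ → M
  | 0 => 1
  | l + 1 => up β a l * β (a + l)

theorem map_cox {N : Type*} [Monoid N] (f : M →* N) {β : ℕ → M} {γ : ℕ → N} {n : ℕ}
    (h : ∀ i < n, f (β i) = γ i) : f (cox β n) = cox γ n := by
  induction n with
  | zero => exact map_one f
  | succ n ih => rw [cox, cox, map_mul, h n (by omega), ih fun i hi => h i (by omega)]

theorem cox_succ' (β : ℕ → M) (n : ℕ) : cox β (n + 1) = cox (fun k => β (k + 1)) n * β 0 := by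
  induction n with
  | zero => simp [cox]
  | succ n ih => rw [cox, ih, cox, mul_assoc]

theorem ofFn_reverse_prod (β : ℕ → M) (n : ℕ) :
    (List.ofFn fun k : Fin n => β k.1).reverse.prod = cox β n := by
  induction n with
  | zero => simp [cox]
  | succ n ih => rw [List.ofFn_succ_last]; simp [cox, ih]

theorem commute_cox {β : ℕ → M} {x : M} {k : ℕ} (h : ∀ i < k, Commute x (β i)) :
    Commute x (cox β k) := by
  induction k with
  | zero => exact Commute.one_right x
  | succ k ih => exact (h k (by omega)).mul_right (ih fun i hi => h i (by omega))

theorem commute_jm {β : ℕ → M} {x : M} {k : ℕ} (h : ∀ i ≤ k, Commute x (β i)) :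
    Commute x (jm β k) := by
  induction k with
  | zero => exact h 0 le_rfl
  | succ k ih =>
    exact ((h _ le_rfl).mul_right (ih fun i hi => h i (by omega))).mul_right (h _ le_rfl)

theorem jm_eq_cox_mul_up (β : ℕ → M) (k : ℕ) : jm β k = cox β (k + 1) * up β 1 k := by
  induction k with
  | zero => simp [jm, cox, up]
  | succ k ih =>
    rw [jm, ih, up, add_comm 1 k, show cox β (k + 1 + 1) = β (k + 1) * cox β (k + 1) from rfl]
    simp only [mul_assoc]

namespace TypeBFamily

variable {n : ℕ} {β : ℕ → M}

theorem commute (h : TypeBFamily n β) {i j : ℕ} (hij : i + 2 ≤ j) (hj : j < n) :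
    Commute (β j) (β i) := (h.comm i j hij hj).symm

/-- If i + 1 < k, then β_i passes both outer letters and the induction applies. If i + 1 = k, the
claim is the double relation for i = 0; otherwise it follows from a braid relation on each side of
the inner palindrome, which commutes with β_{i+1}. -/
theorem commute_jm_of_lt (h : TypeBFamily n β) {i k : ℕ} (hi : i < k) (hk : k < n) :
    Commute (β i) (jm β k) := by
  induction k with
  | zero => omega
  | succ k ih =>
    rcases Nat.lt_succ_iff_lt_or_eq.1 hi with hi | rfl
    · have hc : Commute (β i) (β (k + 1)) := (h.commute (by omega) hk).symm
      exact (hc.mul_right (ih hi (by omega))).mul_right hc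
    cases i with
    | zero =>
      have := h.double hk
      simp only [jm, Commute, SemiconjBy, zero_add]
      simp only [mul_assoc] at this ⊢
      exact this
    | succ i =>
      have hb := h.braid (i + 1) (by omega) hk
      have hc : Commute (β (i + 1 + 1)) (jm β i) :=
        commute_jm fun j hj => h.commute (by omega) hk
      simp only [jm, Commute, SemiconjBy]
      calc β (i + 1) * (β (i + 1 + 1) * (β (i + 1) * jm β i * β (i + 1)) * β (i + 1 + 1))
          = (β (i + 1) * β (i + 1 + 1) * β (i + 1)) * jm β i * β (i + 1) * β (i + 1 + 1) := by
            simp only [mul_assoc]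
        _ = β (i + 1 + 1) * β (i + 1) * (β (i + 1 + 1) * jm β i) * β (i + 1) * β (i + 1 + 1) := by
            rw [hb]; simp only [mul_assoc]
        _ = β (i + 1 + 1) * β (i + 1) * jm β i *
            (β (i + 1 + 1) * β (i + 1) * β (i + 1 + 1)) := by
            rw [hc.eq]; simp only [mul_assoc]
        _ = β (i + 1 + 1) * (β (i + 1) * jm β i * β (i + 1)) * β (i + 1 + 1) * β (i + 1) := by
            rw [← hb]; simp only [mul_assoc]

/-- The Coxeter element shifts indices along the simply laced part of the diagram; the letter β₀ is
excluded. -/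
theorem cox_mul (h : TypeBFamily n β) {i m : ℕ} (hi : 1 ≤ i) (him : i + 1 < m) (hm : m ≤ n) :
    cox β m * β (i + 1) = β i * cox β m := by
  induction m with
  | zero => omega
  | succ m ih =>
    rcases Nat.lt_succ_iff_lt_or_eq.1 him with him | rfl
    · rw [cox, mul_assoc, ih him (by omega), ← mul_assoc, ← mul_assoc,
        (h.commute (by omega) hm).eq]
    · have hc : Commute (β (i + 1)) (cox β i) :=
        commute_cox fun j hj => h.commute (by omega) hm
      rw [cox, cox, mul_assoc, mul_assoc, ← hc.eq, ← mul_assoc, ← mul_assoc, ← h.braid i hi hm]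
      simp only [mul_assoc]

theorem cox_mul_up (h : TypeBFamily n β) {a l m : ℕ} (ha : 1 ≤ a) (hal : a + l < m) (hm : m ≤ n) :
    cox β m * up β (a + 1) l = up β a l * cox β m := by
  induction l with
  | zero => simp [up]
  | succ l ih =>
    rw [up, up, ← mul_assoc, ih (by omega), mul_assoc, show a + 1 + l = a + l + 1 by omega,
      h.cox_mul (by omega) (by omega) hm, mul_assoc]

/-- Each new factor β_m ⋯ β₀ lowers the indices of the ascending product already collected, and its
own β_m completes that product at the top. -/
theorem cox_pow (h : TypeBFamily n β) {m k : ℕ} (hm : m < n) (hk : k ≤ m) :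
    cox β (m + 1) ^ k = up β (m + 1 - k) k * cox β m ^ k := by
  induction k with
  | zero => simp [up]
  | succ k ih =>
    obtain ⟨a, rfl⟩ : ∃ a, m = a + k := ⟨m - k, by omega⟩
    rw [pow_succ', ih (by omega), show a + k + 1 - k = a + 1 by omega, ← mul_assoc,
      h.cox_mul_up (by omega) (by omega) hm, show a + k + 1 - (k + 1) = a by omega, up, pow_succ',
      cox]
    simp only [mul_assoc]

/-- Iterated, this factors the power of the Coxeter element into the palindromes `jm β m`, …, `jm β
0`, the form used in all later arguments. -/
theorem cox_pow_succ (h : TypeBFamily n β) {m : ℕ} (hm : m < n) :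
    cox β (m + 1) ^ (m + 1) = jm β m * cox β m ^ m := by
  rw [pow_succ', h.cox_pow hm le_rfl, jm_eq_cox_mul_up, show m + 1 - m = 1 by omega, mul_assoc]

theorem cox_pow_succ' (h : TypeBFamily n β) {m : ℕ} (hm : m < n) :
    cox β (m + 1) ^ (m + 1) = cox β m ^ m * jm β m := by
  rw [h.cox_pow_succ hm]
  exact ((commute_cox fun i hi => (h.commute_jm_of_lt hi hm).symm).pow_right m).eq

theorem commute_cox_pow (h : TypeBFamily n β) {i m : ℕ} (hi : i < m) (hm : m ≤ n) :
    Commute (β i) (cox β m ^ m) := by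
  induction m with
  | zero => omega
  | succ m ih =>
    rcases Nat.lt_succ_iff_lt_or_eq.1 hi with hi | rfl
    · rw [h.cox_pow_succ hm]
      exact (h.commute_jm_of_lt hi hm).mul_right (ih hi (by omega))
    cases i with
    | zero => simp [cox]
    | succ k =>
      have h₁ : Commute (β (k + 1)) (cox β k ^ k) :=
        (commute_cox fun i hi => h.commute (by omega) hm).pow_right k
      have h₂ : Commute (jm β (k + 1)) (jm β k) :=
        commute_jm fun i hi => (h.commute_jm_of_lt (by omega) hm).symm
      rw [h.cox_pow_succ hm, h.cox_pow_succ (by omega), ← mul_assoc]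
      refine Commute.mul_right ?_ h₁
      -- With b = β_{k+1} and Y = `jm β k`, the relation bYbY = YbYb gives b(bYbY) = b(YbYb) =
      -- (bYbY)b.
      rw [Commute, SemiconjBy]
      conv_lhs => rw [h₂.eq]
      simp only [jm, mul_assoc]

theorem dvd_cox_pow (h : TypeBFamily n β) {i m : ℕ} (hi : i < m) (hm : m ≤ n) :
    β i ∣ cox β m ^ m := by
  induction m with
  | zero => omega
  | succ m ih =>
    rcases Nat.lt_succ_iff_lt_or_eq.1 hi with hi | rfl
    · rw [h.cox_pow_succ' hm]
      exact (ih hi (by omega)).trans (dvd_mul_right _ _)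
    · rw [h.cox_pow_succ hm]
      refine dvd_mul_of_dvd_left ?_ _
      cases i with
      | zero => exact dvd_rfl
      | succ i => rw [jm, mul_assoc]; exact dvd_mul_right _ _

end TypeBFamily

end Family

/-! ### Anti-automorphisms, exchanging left and right divisibility. -/

section Reversal

variable {M : Type*} [Monoid M]

/-- An anti-automorphism of order two. -/
structure IsReversal (σ : M → M) : Prop where
  map_mul : ∀ a b, σ (a * b) = σ b * σ a
  invol : ∀ a, σ (σ a) = a

namespace IsReversal

variable {σ : M → M}

theorem rightDvd_iff (h : IsReversal σ) {a b : M} : Garside.RightDvd a b ↔ σ a ∣ σ b := by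
  constructor
  · rintro ⟨c, rfl⟩
    exact ⟨σ c, h.map_mul _ _⟩
  · rintro ⟨c, hc⟩
    exact ⟨σ c, by rw [← h.invol b, hc, h.map_mul, h.invol]⟩

theorem map_one (h : IsReversal σ) : σ 1 = 1 := by
  have := h.map_mul (σ 1) 1
  rwa [mul_one, h.invol, mul_one, eq_comm] at this

theorem right_cancel (h : IsReversal σ) (hl : ∀ a b c : M, a * b = a * c → b = c) (a b c : M)
    (habc : b * a = c * a) : b = c := by
  have := hl (σ a) (σ b) (σ c) (by rw [← h.map_mul, habc, h.map_mul])
  rw [← h.invol b, this, h.invol]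

theorem isLubFor (h : IsReversal σ) {S : Set M} {x : M}
    (hx : IsLubFor (fun a b => a ∣ b) (σ '' S) (σ x)) : IsLubFor Garside.RightDvd S x := by
  refine ⟨fun a ha => h.rightDvd_iff.2 (hx.1 _ ⟨a, ha, rfl⟩), fun y hy => h.rightDvd_iff.2 ?_⟩
  refine hx.2 _ ?_
  rintro _ ⟨a, ha, rfl⟩
  exact h.rightDvd_iff.1 (hy a ha)

theorem isGlbFor (h : IsReversal σ) {S : Set M} {x : M}
    (hx : IsGlbFor (fun a b => a ∣ b) (σ '' S) (σ x)) : IsGlbFor Garside.RightDvd S x := by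
  refine ⟨fun a ha => h.rightDvd_iff.2 (hx.1 _ ⟨a, ha, rfl⟩), fun y hy => h.rightDvd_iff.2 ?_⟩
  refine hx.2 _ ?_
  rintro _ ⟨a, ha, rfl⟩
  exact h.rightDvd_iff.1 (hy a ha)

theorem isLatticeOrder (h : IsReversal σ) (hl : IsLatticeOrder (fun a b : M => a ∣ b)) :
    IsLatticeOrder (fun a b : M => Garside.RightDvd a b) where
  refl := fun a => ⟨1, (one_mul a).symm⟩
  trans := fun a b c hab hbc =>
    h.rightDvd_iff.2 ((h.rightDvd_iff.1 hab).trans (h.rightDvd_iff.1 hbc))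
  antisymm := fun a b hab hba => by
    rw [← h.invol a, hl.antisymm _ _ (h.rightDvd_iff.1 hab) (h.rightDvd_iff.1 hba), h.invol]
  exists_lub := fun a b => by
    obtain ⟨x, hx⟩ := hl.exists_lub (σ a) (σ b)
    exact ⟨σ x, h.isLubFor (by rwa [Set.image_pair, h.invol])⟩
  exists_glb := fun a b => by
    obtain ⟨x, hx⟩ := hl.exists_glb (σ a) (σ b)
    exact ⟨σ x, h.isGlbFor (by rwa [Set.image_pair, h.invol])⟩

theorem map_jm (h : IsReversal σ) {β : ℕ → M} (hβ : ∀ i, σ (β i) = β i) (k : ℕ) :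
    σ (jm β k) = jm β k := by
  induction k with
  | zero => exact hβ 0
  | succ k ih => rw [jm, h.map_mul, h.map_mul, ih, hβ, mul_assoc]

/-- Reversal fixes each palindrome and only permutes the factors, so the two orders of the
factorization suffice. -/
theorem map_cox_pow (h : IsReversal σ) {β : ℕ → M} {n : ℕ} (hβ : ∀ i, σ (β i) = β i)
    (hf : TypeBFamily n β) {m : ℕ} (hm : m ≤ n) : σ (cox β m ^ m) = cox β m ^ m := by
  induction m with
  | zero => simpa using h.map_one
  | succ m ih =>
    rw [hf.cox_pow_succ hm, h.map_mul, h.map_jm hβ, ih (by omega), ← hf.cox_pow_succ' hm,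
      hf.cox_pow_succ hm]

end IsReversal

/-- An anti-automorphism of order two of a presented monoid, from its effect on generators. -/
theorem exists_isReversal {α : Type*} {rel : FreeMonoid α → FreeMonoid α → Prop} (f : α → α)
    (hf : ∀ a, f (f a) = a)
    (hrel : ∀ u v, rel u v →
      ev rel (u.toList.map f).reverse = ev rel (v.toList.map f).reverse) :
    ∃ σ : PresentedMonoid rel → PresentedMonoid rel, IsReversal σ ∧
      ∀ a, σ (PresentedMonoid.of rel a) = PresentedMonoid.of rel (f a) := by
  have key : ∀ u : FreeMonoid α,
      (FreeMonoid.lift (fun a => MulOpposite.op (PresentedMonoid.of rel (f a))) u).unop =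
        ev rel (u.toList.map f).reverse := fun u => by
    induction u with
    | one => rfl
    | of x => simp
    | mul x y hx hy => simp [hx, hy]
  let φ : PresentedMonoid rel →* (PresentedMonoid rel)ᵐᵒᵖ :=
    PresentedMonoid.lift (fun a => MulOpposite.op (PresentedMonoid.of rel (f a)))
      fun u v huv => MulOpposite.unop_injective (by rw [key, key, hrel u v huv])
  have hmul : ∀ a b, (φ (a * b)).unop = (φ b).unop * (φ a).unop := fun a b => by simp
  refine ⟨fun m => (φ m).unop, ⟨hmul, fun m => ?_⟩, fun a => rfl⟩
  obtain ⟨l, rfl⟩ := exists_ev m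
  induction l with
  | nil => simp
  | cons a l ih =>
    rw [ev_cons, hmul, hmul, ih]
    exact congrArg (· * ev rel l) (congrArg (PresentedMonoid.of rel) (hf a))

end Reversal

/-! ### The Garside element of type B as the lcm of the generators. -/

section TypeBLcm

variable {n : ℕ}

/-- The generators of the braid monoid of type `B_n`, numbered from `0` and extended by `1`. -/
def typeBGen (n i : ℕ) : TypeBPos n :=
  if h : 1 ≤ i + 1 ∧ i + 1 ≤ n then TypeBPos.b ⟨i + 1, h⟩ else 1

theorem typeBGen_eq {i : ℕ} (h : i < n) :
    typeBGen n i = PresentedMonoid.of (TypeBRel n) ⟨i + 1, by omega, by omega⟩ :=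
  dif_pos ⟨by omega, by omega⟩

theorem b_eq_typeBGen (i : Set.Icc 1 n) : TypeBPos.b i = typeBGen n (i.1 - 1) := by
  obtain ⟨i, h₁, h₂⟩ := i
  obtain ⟨i, rfl⟩ := Nat.exists_eq_add_of_le' h₁
  exact (typeBGen_eq (by simpa using h₂)).symm

theorem typeB_family (n : ℕ) : TypeBFamily n (typeBGen n) where
  comm := fun i j hij hj => by
    rw [typeBGen_eq hj, typeBGen_eq (by omega)]
    exact typeB_comm_of (.inl (by simpa using hij))
  braid := fun i hi hin => by
    rw [typeBGen_eq hin, typeBGen_eq (by omega)]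
    exact PresentedMonoid.mk_eq_mk_of_rel (TypeBRel.braid _ _ (Nat.lt_succ_of_le hi) rfl)
  double := fun hn => by
    rw [typeBGen_eq hn, typeBGen_eq (by omega)]
    exact PresentedMonoid.mk_eq_mk_of_rel (TypeBRel.double _ _ rfl rfl)

theorem typeB_Delta_eq (n : ℕ) : TypeBPos.Delta n = cox (typeBGen n) n ^ n := by
  rw [TypeBPos.Delta, ← ofFn_reverse_prod]
  congr 4
  funext k
  exact (typeBGen_eq k.2).symm

theorem typeB_reduction_far {i j : ℕ} (hij : i + 2 ≤ j) (hj : j < n) {x y : TypeBPos n}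
    (h : typeBGen n i * x = typeBGen n j * y) : ∃ z, x = typeBGen n j * z := by
  rw [typeBGen_eq (by omega), typeBGen_eq hj] at h
  obtain ⟨z, hz, -⟩ := (typeB_isComplemented n).reduction h
  rw [typeBC_far (.inl (by simpa using hij))] at hz
  exact ⟨z, by rw [typeBGen_eq hj]; simpa using hz⟩

theorem typeB_reduction_braid {i : ℕ} (hi : 1 ≤ i) (hin : i + 1 < n) {x y : TypeBPos n}
    (h : typeBGen n i * x = typeBGen n (i + 1) * y) :
    ∃ z, x = typeBGen n (i + 1) * (typeBGen n i * z) ∧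
      y = typeBGen n i * (typeBGen n (i + 1) * z) := by
  rw [typeBGen_eq (i := i) (by omega), typeBGen_eq hin] at *
  obtain ⟨z, hz, hz'⟩ := (typeB_isComplemented n).reduction h
  rw [typeBC_adj (.inl rfl) (Nat.lt_succ_of_le hi) (by simp)] at hz
  rw [typeBC_adj (.inr rfl) (by simp) (Nat.lt_succ_of_le hi)] at hz'
  exact ⟨z, by simpa [mul_assoc] using hz, by simpa [mul_assoc] using hz'⟩

theorem typeB_reduction_double (hn : 1 < n) {x y : TypeBPos n}
    (h : typeBGen n 0 * x = typeBGen n 1 * y) :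
    ∃ z, x = typeBGen n 1 * (typeBGen n 0 * (typeBGen n 1 * z)) := by
  rw [typeBGen_eq (i := 0) (by omega), typeBGen_eq hn] at *
  obtain ⟨z, hz, -⟩ := (typeB_isComplemented n).reduction h
  rw [typeBC_double (.inl ⟨rfl, rfl⟩)] at hz
  exact ⟨z, by simpa [mul_assoc] using hz⟩

theorem typeB_dvd_of_far {i j : ℕ} (hij : i + 2 ≤ j) (hj : j < n) {u : TypeBPos n}
    (h : typeBGen n j ∣ typeBGen n i * u) : typeBGen n j ∣ u := by
  obtain ⟨c, hc⟩ := h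
  obtain ⟨z, hz⟩ := typeB_reduction_far hij hj hc
  exact ⟨z, hz⟩

theorem typeB_dvd_of_dvd_jm_mul {k j : ℕ} (hkj : k + 2 ≤ j) (hj : j < n) {u : TypeBPos n}
    (h : typeBGen n j ∣ jm (typeBGen n) k * u) : typeBGen n j ∣ u := by
  induction k generalizing u with
  | zero => exact typeB_dvd_of_far hkj hj h
  | succ k ih =>
    rw [jm, mul_assoc, mul_assoc] at h
    exact typeB_dvd_of_far hkj hj (ih (by omega) (typeB_dvd_of_far hkj hj h))

theorem typeB_dvd_of_dvd_cox_mul {k j : ℕ} (hkj : k + 1 ≤ j) (hj : j < n) {u : TypeBPos n}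
    (h : typeBGen n j ∣ cox (typeBGen n) k * u) : typeBGen n j ∣ u := by
  induction k with
  | zero => simpa [cox] using h
  | succ k ih =>
    rw [cox, mul_assoc] at h
    exact ih (by omega) (typeB_dvd_of_far (by omega) hj h)

/-- This is the minimality half of the lcm: a multiple of Y_k = `jm (typeBGen n) k` divisible by the
next generator must already contain Y_k Y_{k+1}. The induction peels q p Y p q off z, alternating
the reduction property, the commutation of q with Y, and cancellation. -/
theorem typeB_jm_dvd {k : ℕ} (hk : k + 1 < n) {z : TypeBPos n}
    (h : typeBGen n (k + 1) ∣ jm (typeBGen n) k * z) : jm (typeBGen n) (k + 1) ∣ z := by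
  have cancel := (typeB_isComplemented n).left_cancel
  induction k generalizing z with
  | zero =>
    obtain ⟨w, hw⟩ := h
    obtain ⟨z', rfl⟩ := typeB_reduction_double hk hw
    exact ⟨z', by simp [jm, mul_assoc]⟩
  | succ k ih =>
    have hc : Commute (typeBGen n (k + 1 + 1)) (jm (typeBGen n) k) :=
      commute_jm fun i hi => (typeB_family n).commute (by omega) hk
    have hb := (typeB_family n).braid (k + 1) (by omega) hk
    set p := typeBGen n (k + 1)
    set q := typeBGen n (k + 1 + 1)
    set Y := jm (typeBGen n) k with hY
    have hjm : jm (typeBGen n) (k + 1) = p * Y * p := rfl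
    have hjm' : jm (typeBGen n) (k + 1 + 1) = q * (p * Y * p) * q := rfl
    obtain ⟨w, hw⟩ := h
    rw [hjm, mul_assoc, mul_assoc] at hw
    obtain ⟨z₂, hz₂, -⟩ := typeB_reduction_braid (by omega) hk hw
    obtain ⟨z₃, hz₃⟩ := typeB_dvd_of_dvd_jm_mul le_rfl hk ⟨_, hz₂⟩
    obtain ⟨z₄, rfl, rfl⟩ := typeB_reduction_braid (by omega) hk hz₃
    have h₁ : Y * (p * (q * z₄)) = p * z₂ := by
      refine cancel q _ _ ?_
      rw [← mul_assoc, hc.eq, mul_assoc, ← hz₃]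
      exact hz₂
    obtain ⟨z₅, hz₅⟩ := ih (by omega) ⟨_, h₁⟩
    have h₂ : q * z₄ = Y * (p * z₅) := cancel p _ _ (by rw [hz₅, hjm]; simp only [mul_assoc])
    obtain ⟨z₆, hz₆⟩ := typeB_dvd_of_dvd_jm_mul le_rfl hk ⟨_, h₂.symm⟩
    obtain ⟨z₇, rfl, rfl⟩ := typeB_reduction_braid (by omega) hk hz₆
    have h₃ : z₄ = Y * (p * (q * z₇)) := by
      refine cancel q _ _ ?_
      rw [h₂, hz₆, ← mul_assoc, ← hc.eq, mul_assoc]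
    exact ⟨z₇, by rw [h₃, hjm']; simp only [mul_assoc]; rfl⟩

/-- The generators are absorbed one at a time: divisibility by the next generator forces the next
palindrome into the remaining right factor. -/
theorem typeB_cox_pow_dvd {y : TypeBPos n} (hy : ∀ i < n, typeBGen n i ∣ y) {m : ℕ} (hm : m ≤ n) :
    cox (typeBGen n) m ^ m ∣ y := by
  induction m with
  | zero => simp
  | succ m ih =>
    obtain ⟨u, rfl⟩ := ih (by omega)
    rw [(typeB_family n).cox_pow_succ' hm]
    refine mul_dvd_mul_left _ ?_
    have h := hy m hm
    cases m with
    | zero => simpa [jm] using h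
    | succ m =>
      refine typeB_jm_dvd hm ?_
      rw [(typeB_family n).cox_pow_succ' (by omega), mul_assoc] at h
      generalize jm (typeBGen n) m * u = v at h ⊢
      -- All letters of `cox (typeBGen n) m` are far from the generator m + 1, so they can be
      -- stripped off.
      have : ∀ k, typeBGen n (m + 1) ∣ cox (typeBGen n) m ^ k * v → typeBGen n (m + 1) ∣ v := by
        intro k
        induction k with
        | zero => simp
        | succ k ih =>
          rw [pow_succ', mul_assoc]
          exact fun h => ih (typeB_dvd_of_dvd_cox_mul le_rfl hm h)
      exact this m h

theorem typeB_isLubFor (n : ℕ) :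
    IsLubFor (fun a b => a ∣ b) (Set.range (TypeBPos.b (n := n))) (cox (typeBGen n) n ^ n) := by
  constructor
  · rintro _ ⟨i, rfl⟩
    rw [b_eq_typeBGen]
    exact (typeB_family n).dvd_cox_pow (by have := i.2.1; have := i.2.2; omega) le_rfl
  · intro y hy
    refine typeB_cox_pow_dvd (fun i hi => hy _ ⟨⟨i + 1, by omega, by omega⟩, ?_⟩) le_rfl
    exact (typeBGen_eq hi).symm

theorem typeB_exists_isReversal (n : ℕ) : ∃ σ : TypeBPos n → TypeBPos n, IsReversal σ ∧
    ∀ i, σ (TypeBPos.b i) = TypeBPos.b i := by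
  refine exists_isReversal id (fun _ => rfl) fun u v h => ?_
  have of_rel : ∀ {u v : List (Set.Icc 1 n)},
      TypeBRel n (FreeMonoid.ofList u) (FreeMonoid.ofList v) →
      ev (TypeBRel n) u = ev (TypeBRel n) v := fun h => ev_eq_ev_iff.2 (.of _ _ h)
  cases h with
  | comm i j h => exact (of_rel (TypeBRel.comm i j h)).symm
  | braid i j h₁ h => exact of_rel (TypeBRel.braid i j h₁ h)
  | double i j h₁ h₂ => exact (of_rel (TypeBRel.double i j h₁ h₂)).symm

theorem typeB_isDelta (n : ℕ) : (TypeBPos.Delta n).IsDelta := by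
  obtain ⟨σ, hσ, hb⟩ := typeB_exists_isReversal n
  have hβ : ∀ i, σ (typeBGen n i) = typeBGen n i := fun i => by
    unfold typeBGen
    split_ifs
    · exact hb _
    · exact hσ.map_one
  rw [typeB_Delta_eq]
  refine ⟨typeB_isLubFor n, hσ.isLubFor ?_⟩
  rw [hσ.map_cox_pow hβ (typeB_family n) le_rfl, ← Set.range_comp,
    show σ ∘ TypeBPos.b (n := n) = TypeBPos.b from funext hb]
  exact typeB_isLubFor n

end TypeBLcm

end ImprimitiveBraid

/-! ### Groups of fractions and quasi-central elements. -/

namespace Garside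

universe u

/-- A cancellative monoid with common left multiples embeds in a group. -/
theorem exists_injective_to_group {M : Type u} [Monoid M]
    (hlc : ∀ a b c : M, a * b = a * c → b = c) (hrc : ∀ a b c : M, b * a = c * a → b = c)
    (hore : ∀ x y : M, ∃ a b, a * x = b * y) :
    ∃ (G : Type u) (_ : Group G) (f : M →* G), Function.Injective f := by
  choose p q hpq using hore
  let _ : OreLocalization.OreSet (⊤ : Submonoid M) :=
    { ore_right_cancel := fun r₁ r₂ s h => ⟨1, by rw [hrc _ _ _ h]⟩
      oreNum := fun x s => q x s
      oreDenom := fun x s => ⟨p x s, trivial⟩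
      ore_eq := fun x s => hpq x s }
  let f : M →* OreLocalization (⊤ : Submonoid M) M := OreLocalization.numeratorHom
  have hf : ∀ x, IsUnit (f x) := fun x =>
    OreLocalization.numerator_isUnit (⟨x, trivial⟩ : (⊤ : Submonoid M))
  refine ⟨(OreLocalization (⊤ : Submonoid M) M)ˣ, inferInstance, IsUnit.liftRight f hf, ?_⟩
  intro x y hxy
  have h : f x = f y := by
    rw [← IsUnit.coe_liftRight f hf x, ← IsUnit.coe_liftRight f hf y, hxy]
  simp only [f, OreLocalization.numeratorHom_apply] at h
  -- Both denominators are 1, so u and v coincide and left cancellation concludes.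
  obtain ⟨u, v, h₁, h₂⟩ := OreLocalization.oreDiv_eq_iff.1 h
  simp only [OneMemClass.coe_one, mul_one] at h₂
  have h₃ : v * y = v * x := by
    rw [← h₂]
    simpa [Submonoid.smul_def, h₂] using h₁
  exact (hlc _ _ _ h₃).symm

/-- An injective homomorphism whose image generates the group exhibits the group as a group of
fractions when common multiples exist on both sides. -/
theorem isGroupOfFractions {M G : Type*} [Monoid M] [Group G] {ι : M →* G}
    (hι : Function.Injective ι) (hl : ∀ x y : M, ∃ a b, a * x = b * y)
    (hr : ∀ x y : M, ∃ a b, x * a = y * b) (hgen : Subgroup.closure (Set.range ι) = ⊤) :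
    IsGroupOfFractions ι where
  injective := hι
  left_fraction := fun g => by
    have hg : g ∈ Subgroup.closure (Set.range ι) := hgen ▸ Subgroup.mem_top g
    induction hg using Subgroup.closure_induction with
    | mem x hx => obtain ⟨b, rfl⟩ := hx; exact ⟨1, b, by simp⟩
    | one => exact ⟨1, 1, by simp⟩
    | inv x _ ih => obtain ⟨a, b, rfl⟩ := ih; exact ⟨b, a, by simp⟩
    | mul x y _ _ ihx ihy =>
      obtain ⟨a, b, rfl⟩ := ihx
      obtain ⟨c, d, rfl⟩ := ihy
      obtain ⟨p, q, h⟩ := hl b c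
      have h' := congrArg ι h
      rw [map_mul, map_mul] at h'
      refine ⟨p * a, q * d, ?_⟩
      rw [eq_inv_mul_iff_mul_eq, map_mul, map_mul]
      calc ι p * ι a * ((ι a)⁻¹ * ι b * ((ι c)⁻¹ * ι d)) = ι p * ι b * (ι c)⁻¹ * ι d := by group
        _ = ι q * ι d := by rw [h']; group
  right_fraction := fun g => by
    have hg : g ∈ Subgroup.closure (Set.range ι) := hgen ▸ Subgroup.mem_top g
    induction hg using Subgroup.closure_induction with
    | mem x hx => obtain ⟨b, rfl⟩ := hx; exact ⟨b, 1, by simp⟩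
    | one => exact ⟨1, 1, by simp⟩
    | inv x _ ih => obtain ⟨a, b, rfl⟩ := ih; exact ⟨b, a, by simp⟩
    | mul x y _ _ ihx ihy =>
      obtain ⟨a, b, rfl⟩ := ihx
      obtain ⟨c, d, rfl⟩ := ihy
      obtain ⟨p, q, h⟩ := hr b c
      have h' := congrArg ι h
      rw [map_mul, map_mul] at h'
      refine ⟨a * p, d * q, ?_⟩
      rw [eq_mul_inv_iff_mul_eq, map_mul, map_mul]
      calc ι a * (ι b)⁻¹ * (ι c * (ι d)⁻¹) * (ι d * ι q)
          = ι a * (ι b)⁻¹ * (ι c * ι q) := by group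
        _ = ι a * ι p := by rw [← h']; group

section QuasiCentral

variable {M : Type*} [Monoid M] {Λ : M} {φ : MulAut M}

theorem rightDvd_of_dvd_of_quasiCentral (hrc : ∀ a b c : M, b * a = c * a → b = c)
    (h : ∀ g, Λ * g = φ g * Λ) {a : M} (ha : a ∣ Λ) : Garside.RightDvd a Λ := by
  obtain ⟨c, hc⟩ := ha
  exact ⟨φ c, hrc c _ _ (by rw [h c, mul_assoc, ← hc])⟩

theorem dvd_of_rightDvd_of_quasiCentral (hlc : ∀ a b c : M, a * b = a * c → b = c)
    (h : ∀ g, Λ * g = φ g * Λ) {a : M} (ha : Garside.RightDvd a Λ) : a ∣ Λ := by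
  obtain ⟨c, hc⟩ := ha
  refine ⟨φ.symm c, hlc c _ _ ?_⟩
  have := h (φ.symm c)
  rw [MulEquiv.apply_symm_apply] at this
  rw [← this, ← mul_assoc, ← hc]

theorem exists_mul_pow_of_quasiCentral (h : ∀ g, Λ * g = φ g * Λ) (k : ℕ) (c : M) :
    ∃ c', c * Λ ^ k = Λ ^ k * c' := by
  induction k generalizing c with
  | zero => exact ⟨c, by simp⟩
  | succ k ih =>
    obtain ⟨c', hc'⟩ := ih (φ.symm c)
    refine ⟨c', ?_⟩
    have := h (φ.symm c)
    rw [MulEquiv.apply_symm_apply] at this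
    rw [pow_succ', ← mul_assoc, ← this, mul_assoc, hc', mul_assoc]

/-- If every element of a generating set divides the quasi-central element `Λ`, then every element
divides a power of `Λ`. -/
theorem exists_dvd_pow_of_quasiCentral (h : ∀ g, Λ * g = φ g * Λ) {S : Set M}
    (hS : ∀ a ∈ S, a ∣ Λ) (hgen : Submonoid.closure S = ⊤) (x : M) : ∃ k, x ∣ Λ ^ k := by
  have hx : x ∈ Submonoid.closure S := hgen ▸ Submonoid.mem_top x
  induction hx using Submonoid.closure_induction with
  | mem x hx => exact ⟨1, by simpa using hS x hx⟩
  | one => exact ⟨0, by simp⟩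
  | mul x y _ _ ihx ihy =>
    obtain ⟨k, c, hc⟩ := ihx
    obtain ⟨l, d, hd⟩ := ihy
    obtain ⟨c', hc'⟩ := exists_mul_pow_of_quasiCentral h l c
    refine ⟨k + l, d * c', ?_⟩
    rw [pow_add, hc, mul_assoc, hc', hd]
    simp only [mul_assoc]

theorem exists_common_multiple_of_quasiCentral (h : ∀ g, Λ * g = φ g * Λ) {S : Set M}
    (hS : ∀ a ∈ S, a ∣ Λ) (hgen : Submonoid.closure S = ⊤) (x y : M) : ∃ m, x ∣ m ∧ y ∣ m := by
  obtain ⟨k, hk⟩ := exists_dvd_pow_of_quasiCentral h hS hgen x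
  obtain ⟨l, hl⟩ := exists_dvd_pow_of_quasiCentral h hS hgen y
  exact ⟨Λ ^ max k l, hk.trans (pow_dvd_pow _ (le_max_left _ _)),
    hl.trans (pow_dvd_pow _ (le_max_right _ _))⟩

end QuasiCentral

end Garside

namespace ImprimitiveBraid

open Garside

/-! ### Quasi-centrality of Λ and the quasi-Garside structure. -/

section DualFamily

variable {M : Type*} [Monoid M] {t : ℤ → M} {s D : M} (hd : ∀ i, t (i + 1) * t i = D)

include hd

/-- Both sides are t_{i+2} t_{i+1} t_i, bracketed in two ways. -/
theorem dual_mul (i : ℤ) : D * t i = t (i + 2) * D := by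
  rw [← hd (i + 1), mul_assoc, hd (i + 1), hd i, add_assoc, one_add_one_eq_two]

variable (hb : ∀ i, s * t i * s = t i * s * t i)

include hb

theorem conj_mul (i : ℤ) : s * D * s * t i = t (i + 1) * (s * D * s) := by
  have h₁ := hb i
  have h₂ := hb (i + 1)
  calc s * D * s * t i = s * t (i + 1) * (t i * s * t i) := by
        rw [← hd i]; simp only [mul_assoc]
    _ = (s * t (i + 1) * s) * t i * s := by rw [← h₁]; simp only [mul_assoc]
    _ = t (i + 1) * (s * (t (i + 1) * t i) * s) := by rw [h₂]; simp only [mul_assoc]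
    _ = _ := by rw [hd]

/-- Moving s D s across t₁ and t₀ turns D = t₁t₀ into t₂t₁, which is D again. So the double relation
follows from the positive presentation. -/
theorem dual_double : D * s * D * s = s * D * s * D := by
  calc D * s * D * s = t (0 + 1 + 1) * (t (0 + 1) * (s * D * s)) := by
        rw [← hd (0 + 1)]; simp only [mul_assoc]
    _ = s * D * s * D := by
        rw [← conj_mul hd hb, ← mul_assoc, ← conj_mul hd hb, mul_assoc, hd]

end DualFamily

section Positive

variable {r : ℕ}

theorem BInfPos.dual (i : ℤ) :
    BInfPos.t (r := r) (i + 1) * BInfPos.t i = BInfPos.t 1 * BInfPos.t 0 := by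
  have := PresentedMonoid.mk_eq_mk_of_rel (PosRel.dual (r := r) (i + 1) 1)
  rw [add_sub_cancel_right, sub_self] at this
  exact this

theorem BInfPos.comm_s {i j : Set.Icc 3 r} (h : i.1 + 2 ≤ j.1) :
    BInfPos.s i * BInfPos.s j = BInfPos.s j * BInfPos.s i :=
  PresentedMonoid.mk_eq_mk_of_rel (PosRel.comm_s i j h)

theorem BInfPos.braid_s {i j : Set.Icc 3 r} (h : i.1 + 1 = j.1) :
    BInfPos.s i * BInfPos.s j * BInfPos.s i = BInfPos.s j * BInfPos.s i * BInfPos.s j :=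
  PresentedMonoid.mk_eq_mk_of_rel (PosRel.braid_s i j h)

theorem BInfPos.braid_t {j : Set.Icc 3 r} (hj : j.1 = 3) (i : ℤ) :
    BInfPos.s j * BInfPos.t i * BInfPos.s j = BInfPos.t i * BInfPos.s j * BInfPos.t i :=
  PresentedMonoid.mk_eq_mk_of_rel (PosRel.braid_t i j hj)

theorem BInfPos.comm_t {j : Set.Icc 3 r} (hj : 4 ≤ j.1) (i : ℤ) :
    BInfPos.s j * BInfPos.t i = BInfPos.t i * BInfPos.s j :=
  PresentedMonoid.mk_eq_mk_of_rel (PosRel.comm_t i j hj)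

/-- The images in `B⁺(∞,∞,r)` of the generators of the braid monoid of type `B_{r-1}`. -/
def posGen (r i : ℕ) : BInfPos r :=
  if i = 0 then BInfPos.t 1 * BInfPos.t 0
  else if h : 3 ≤ i + 2 ∧ i + 2 ≤ r then BInfPos.s ⟨i + 2, h⟩ else 1

theorem posGen_zero : posGen r 0 = BInfPos.t 1 * BInfPos.t 0 := if_pos rfl

theorem posGen_succ {i : ℕ} (h : i + 1 < r - 1) :
    posGen r (i + 1) = BInfPos.s ⟨i + 3, by omega, by omega⟩ := by
  rw [posGen, if_neg (by omega), dif_pos ⟨by omega, by omega⟩]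

theorem s_eq_posGen (j : Set.Icc 3 r) : BInfPos.s j = posGen r (j.1 - 2) := by
  obtain ⟨j, h₁, h₂⟩ := j
  obtain ⟨j, rfl⟩ := Nat.exists_eq_add_of_le' h₁
  exact (posGen_succ (by omega)).symm

theorem pos_family (r : ℕ) : TypeBFamily (r - 1) (posGen r) where
  comm := fun i j hij hj => by
    obtain ⟨j, rfl⟩ : ∃ j', j = j' + 1 := ⟨j - 1, by omega⟩
    rw [posGen_succ hj]
    cases i with
    | zero =>
      have h : ∀ k, Commute (BInfPos.t (r := r) k) (BInfPos.s ⟨j + 3, by omega, by omega⟩) :=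
        fun k => (BInfPos.comm_t (by simp; omega) k).symm
      rw [posGen_zero]
      exact (h 1).mul_left (h 0)
    | succ i =>
      rw [posGen_succ (by omega)]
      exact BInfPos.comm_s (by simp; omega)
  braid := fun i hi hin => by
    obtain ⟨i, rfl⟩ : ∃ i', i = i' + 1 := ⟨i - 1, by omega⟩
    rw [posGen_succ hin, posGen_succ (by omega)]
    exact BInfPos.braid_s rfl
  double := fun hn => by
    rw [posGen_zero, posGen_succ hn]
    exact dual_double BInfPos.dual (BInfPos.braid_t rfl)

theorem Lam_eq (hr : 2 ≤ r) : BInfPos.Lam r = cox (posGen r) (r - 1) ^ (r - 1) := by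
  obtain ⟨n, rfl⟩ : ∃ n, r = n + 2 := ⟨r - 2, by omega⟩
  rw [BInfPos.Lam, mul_assoc, ← posGen_zero]
  congr 1
  -- Splitting off the last factor t₁t₀ of the Coxeter element leaves s_r ⋯ s₃.
  rw [show n + 2 - 1 = n + 1 by omega, cox_succ', ← ofFn_reverse_prod, BInfPos.A]
  congr 4
  funext k
  exact (posGen_succ (by have := k.2; omega)).symm

/-- The core s₃ t₁t₀ s₃ shifts the index by 1, and the outer letters s_j with j ≥ 4 commute with
every t_i. -/
theorem jm_mul_t {k : ℕ} (hk : k + 1 < r - 1) (i : ℤ) :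
    jm (posGen r) (k + 1) * BInfPos.t i = BInfPos.t (i + 1) * jm (posGen r) (k + 1) := by
  induction k generalizing i with
  | zero =>
    rw [jm, jm, zero_add, posGen_zero, posGen_succ hk]
    exact conj_mul BInfPos.dual (BInfPos.braid_t rfl) i
  | succ k ih =>
    have hc : ∀ i, posGen r (k + 1 + 1) * BInfPos.t i = BInfPos.t i * posGen r (k + 1 + 1) := by
      rw [posGen_succ hk]
      exact BInfPos.comm_t (by simp)
    rw [jm, mul_assoc, hc, ← mul_assoc, mul_assoc _ _ (BInfPos.t i), ih (by omega),
      ← mul_assoc (posGen r (k + 1 + 1)), hc]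
    simp only [mul_assoc]

/-- The shift m + 2 is 2 from the factor t₁t₀ plus 1 from each of the m other palindromes; m = r - 2
gives the shift r of Λ. -/
theorem cox_pow_mul_t {m : ℕ} (hm : m < r - 1) (i : ℤ) :
    cox (posGen r) (m + 1) ^ (m + 1) * BInfPos.t i =
      BInfPos.t (i + (m + 2 : ℕ)) * cox (posGen r) (m + 1) ^ (m + 1) := by
  induction m generalizing i with
  | zero =>
    simp only [cox, zero_add, pow_one, mul_one, posGen_zero]
    exact dual_mul BInfPos.dual i
  | succ m ih =>
    rw [(pos_family r).cox_pow_succ hm, mul_assoc, ih (by omega), ← mul_assoc, jm_mul_t hm,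
      mul_assoc, show i + ((m + 2 : ℕ) : ℤ) + 1 = i + ((m + 1 + 2 : ℕ) : ℤ) by push_cast; ring]

/-- The endomorphism of `B⁺(∞,∞,r)` that shifts the indices of the `t_i` by `m`. -/
def shift (r : ℕ) (m : ℤ) : BInfPos r →* BInfPos r :=
  PresentedMonoid.lift
    (fun
      | .t i => BInfPos.t (i + m)
      | .s j => BInfPos.s j)
    fun u v h => by
      cases h with
      | comm_s i j h => exact PresentedMonoid.mk_eq_mk_of_rel (PosRel.comm_s i j h)
      | braid_s i j h => exact PresentedMonoid.mk_eq_mk_of_rel (PosRel.braid_s i j h)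
      | dual i j =>
        have h := PresentedMonoid.mk_eq_mk_of_rel (PosRel.dual (r := r) (i + m) (j + m))
        rw [add_sub_right_comm, add_sub_right_comm] at h
        exact h
      | braid_t i j h => exact PresentedMonoid.mk_eq_mk_of_rel (PosRel.braid_t (i + m) j h)
      | comm_t i j h => exact PresentedMonoid.mk_eq_mk_of_rel (PosRel.comm_t (i + m) j h)

@[simp] theorem shift_t (m i : ℤ) : shift r m (BInfPos.t i) = BInfPos.t (i + m) := rfl

@[simp] theorem shift_s (m : ℤ) (j : Set.Icc 3 r) : shift r m (BInfPos.s j) = BInfPos.s j := rfl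

theorem BInfPos.hom_ext {N : Type*} [Monoid N] {f g : BInfPos r →* N}
    (ht : ∀ i, f (BInfPos.t i) = g (BInfPos.t i)) (hs : ∀ j, f (BInfPos.s j) = g (BInfPos.s j)) :
    f = g := by
  refine PresentedMonoid.ext (PosRel r) fun x => ?_
  cases x with
  | t i => exact ht i
  | s j => exact hs j

theorem shift_shift (m k : ℤ) (g : BInfPos r) : shift r m (shift r k g) = shift r (k + m) g := by
  have : (shift r m).comp (shift r k) = shift r (k + m) :=
    BInfPos.hom_ext (fun i => by simp [add_assoc]) (fun j => rfl)
  exact DFunLike.congr_fun this g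

theorem shift_zero (g : BInfPos r) : shift r 0 g = g := by
  have : shift r 0 = MonoidHom.id _ :=
    BInfPos.hom_ext (fun i => by simp) (fun j => rfl)
  exact DFunLike.congr_fun this g

/-- The automorphism of `B⁺(∞,∞,r)` that sends `t_i` to `t_{i+1}` and fixes the `s_j`. -/
def diagramAut (r : ℕ) : MulAut (BInfPos r) where
  toFun := shift r 1
  invFun := shift r (-1)
  left_inv := fun g => by rw [shift_shift, add_neg_cancel, shift_zero]
  right_inv := fun g => by rw [shift_shift, neg_add_cancel, shift_zero]
  map_mul' := map_mul _

theorem diagramAut_pow (k : ℕ) (g : BInfPos r) : (diagramAut r ^ k) g = shift r k g := by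
  induction k generalizing g with
  | zero => simp [shift_zero]
  | succ k ih =>
    rw [pow_succ, MulAut.mul_apply, ih]
    change shift r k (shift r 1 g) = _
    rw [shift_shift, add_comm]
    push_cast
    rfl

theorem commute_Lam_s (hr : 2 ≤ r) (j : Set.Icc 3 r) :
    BInfPos.Lam r * BInfPos.s j = BInfPos.s j * BInfPos.Lam r := by
  have h₁ := j.2.1
  have h₂ := j.2.2
  rw [Lam_eq hr, s_eq_posGen]
  exact ((pos_family r).commute_cox_pow (by omega) le_rfl).eq.symm

theorem Lam_mul (hr : 2 ≤ r) (g : BInfPos r) :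
    BInfPos.Lam r * g = (diagramAut r ^ r) g * BInfPos.Lam r := by
  have hg : g ∈ Submonoid.closure (Set.range (PresentedMonoid.of (PosRel r))) := by
    rw [PresentedMonoid.closure_range_of]; exact Submonoid.mem_top g
  induction hg using Submonoid.closure_induction with
  | mem x hx =>
    obtain ⟨x, rfl⟩ := hx
    rw [diagramAut_pow]
    cases x with
    | t i =>
      have h := cox_pow_mul_t (r := r) (m := r - 2) (by omega) i
      rw [show r - 2 + 1 = r - 1 by omega, show r - 2 + 2 = r by omega, ← Lam_eq hr] at h
      exact h
    | s j => exact commute_Lam_s hr j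
  | one => simp
  | mul x y _ _ hx hy => rw [← mul_assoc, hx, mul_assoc, hy, map_mul, mul_assoc]

theorem t_dvd_Lam (hr : 2 ≤ r) (i : ℤ) : BInfPos.t i ∣ BInfPos.Lam r := by
  have h : posGen r 0 ∣ BInfPos.Lam r := by
    rw [Lam_eq hr]
    exact (pos_family r).dvd_cox_pow (by omega) le_rfl
  refine Dvd.dvd.trans ⟨BInfPos.t (i - 1), ?_⟩ h
  rw [posGen_zero, ← BInfPos.dual (i - 1), sub_add_cancel]

theorem s_dvd_Lam (hr : 2 ≤ r) (j : Set.Icc 3 r) : BInfPos.s j ∣ BInfPos.Lam r := by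
  have h₁ := j.2.1
  have h₂ := j.2.2
  rw [Lam_eq hr, s_eq_posGen]
  exact (pos_family r).dvd_cox_pow (by omega) le_rfl

theorem of_dvd_Lam (hr : 2 ≤ r) :
    ∀ a ∈ Set.range (PresentedMonoid.of (PosRel r)), a ∣ BInfPos.Lam r := by
  rintro _ ⟨x, rfl⟩
  cases x with
  | t i => exact t_dvd_Lam hr i
  | s j => exact s_dvd_Lam hr j

/-- Negating the indices is what makes reversal respect the dual relation: t_i t_{i-1} becomes
t_{1-i} t_{-i}. -/
theorem pos_exists_isReversal (r : ℕ) : ∃ σ : BInfPos r → BInfPos r, IsReversal σ := by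
  obtain ⟨σ, hσ, -⟩ := exists_isReversal (rel := PosRel r)
    (fun
      | .t i => .t (-i)
      | .s j => .s j)
    (fun a => by cases a <;> simp) fun u v h => by
      have of_rel : ∀ {u v : List (PosGen r)},
          PosRel r (FreeMonoid.ofList u) (FreeMonoid.ofList v) →
          ev (PosRel r) u = ev (PosRel r) v := fun h => ev_eq_ev_iff.2 (.of _ _ h)
      cases h with
      | comm_s i j h => exact (of_rel (PosRel.comm_s i j h)).symm
      | braid_s i j h => exact of_rel (PosRel.braid_s i j h)
      | dual i j =>
        have h := of_rel (PosRel.dual (-(i - 1)) (-(j - 1)))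
        rw [show -(i - 1) - 1 = -i by ring, show -(j - 1) - 1 = -j by ring] at h
        exact h
      | braid_t i j h => exact of_rel (PosRel.braid_t (-i) j h)
      | comm_t i j h => exact (of_rel (PosRel.comm_t (-i) j h)).symm
  exact ⟨σ, hσ⟩

theorem pos_common_right_multiple (hr : 2 ≤ r) (x y : BInfPos r) : ∃ m, x ∣ m ∧ y ∣ m :=
  exists_common_multiple_of_quasiCentral (Lam_mul hr) (of_dvd_Lam hr)
    (PresentedMonoid.closure_range_of _) x y

theorem pos_left_cancel (a b c : BInfPos r) (h : a * b = a * c) : b = c :=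
  (pos_isComplemented r).left_cancel a b c h

theorem pos_right_cancel (a b c : BInfPos r) (h : b * a = c * a) : b = c := by
  obtain ⟨σ, hσ⟩ := pos_exists_isReversal r
  exact hσ.right_cancel pos_left_cancel a b c h

theorem pos_isQuasiGarside (hr : 2 ≤ r) : IsQuasiGarside (BInfPos r) (BInfPos.Lam r) where
  atomic := (pos_isComplemented r).isAtomicMonoid
  left_cancel := pos_left_cancel
  right_cancel := pos_right_cancel
  left_lattice := (pos_isComplemented r).isLatticeOrder (pos_common_right_multiple hr)
  right_lattice := by
    obtain ⟨σ, hσ⟩ := pos_exists_isReversal r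
    exact hσ.isLatticeOrder ((pos_isComplemented r).isLatticeOrder (pos_common_right_multiple hr))
  garside :=
    { balanced := Set.Subset.antisymm
        (fun _ => rightDvd_of_dvd_of_quasiCentral pos_right_cancel (Lam_mul hr))
        (fun _ => dvd_of_rightDvd_of_quasiCentral pos_left_cancel (Lam_mul hr))
      generates := top_le_iff.1 <| (PresentedMonoid.closure_range_of (PosRel r)).symm.le.trans
        (Submonoid.closure_mono (of_dvd_Lam hr)) }

theorem pos_ore_right (hr : 2 ≤ r) (x y : BInfPos r) : ∃ a b, x * a = y * b := by
  obtain ⟨_, ⟨a, rfl⟩, b, hb⟩ := pos_common_right_multiple hr x y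
  exact ⟨a, b, hb⟩

theorem pos_ore_left (hr : 2 ≤ r) (x y : BInfPos r) : ∃ a b, a * x = b * y := by
  obtain ⟨σ, hσ⟩ := pos_exists_isReversal r
  obtain ⟨a, b, h⟩ := pos_ore_right hr (σ x) (σ y)
  refine ⟨σ a, σ b, ?_⟩
  have := congrArg σ h
  rwa [hσ.map_mul, hσ.map_mul, hσ.invol, hσ.invol] at this

end Positive

/-! ### The map to `BInf r` and its injectivity. -/

section Group

/-- In a group, the braid relation between `s` and `t i` passes from one index to its
neighbours. -/
theorem braid_of_conj {G : Type*} [Group G] {t : ℤ → G} {s D : G}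
    (hd : ∀ i, t (i + 1) * t i = D) (hdouble : s * D * s * D = D * s * D * s)
    (h₀ : s * t 0 * s = t 0 * s * t 0) (h₁ : s * t 1 * s = t 1 * s * t 1) (i : ℤ) :
    s * t i * s = t i * s * t i := by
  have hX₀ : s * D * s * t 0 = t 1 * (s * D * s) := by
    have hd₀ := hd 0
    rw [zero_add] at hd₀
    calc s * D * s * t 0 = s * t 1 * (t 0 * s * t 0) := by
          rw [← hd₀]; simp only [mul_assoc]
      _ = (s * t 1 * s) * t 0 * s := by rw [← h₀]; simp only [mul_assoc]
      _ = t 1 * (s * (t 1 * t 0) * s) := by rw [h₁]; simp only [mul_assoc]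
      _ = _ := by rw [hd₀]
  have hDX : D * (s * D * s) = s * D * s * D := by rw [hdouble]; simp only [mul_assoc]
  -- Since s D s commutes with D = t_{i+1}t_i = t_{i+2}t_{i+1}, the shift relation for one of two
  -- neighbouring indices gives it for the other.
  have hstep : ∀ i, s * D * s * t i = t (i + 1) * (s * D * s) ↔
      s * D * s * t (i + 1) = t (i + 1 + 1) * (s * D * s) := by
    intro i
    have e : s * D * s * t (i + 1) * t i = t (i + 1 + 1) * t (i + 1) * (s * D * s) := by
      rw [mul_assoc _ (t (i + 1)), hd, hd, hDX]
    constructor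
    · intro h
      refine mul_right_cancel (b := t i) ?_
      rw [e, mul_assoc, mul_assoc (t (i + 1 + 1)), h]
    · intro h
      rw [h, mul_assoc (t (i + 1 + 1)) (s * D * s), mul_assoc (t (i + 1 + 1)) (t (i + 1))] at e
      exact mul_left_cancel e
  have hX : ∀ i, s * D * s * t i = t (i + 1) * (s * D * s) := by
    intro i
    induction i using Int.induction_on with
    | zero => simpa using hX₀
    | succ n ih => exact (hstep _).1 ih
    | pred n ih => exact (hstep _).2 (by rwa [sub_add_cancel])
  -- Writing D = t_{i+1}t_i in the shift relation gives an identity containing both sides of the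
  -- braid relations for i and i + 1; either relation yields the other by cancellation.
  have hbr : ∀ i, s * t i * s = t i * s * t i ↔
      s * t (i + 1) * s = t (i + 1) * s * t (i + 1) := by
    intro i
    have e : s * t (i + 1) * (t i * s * t i) = t (i + 1) * s * t (i + 1) * (t i * s) := by
      have := hX i
      rw [← hd i] at this
      simpa only [mul_assoc] using this
    constructor
    · intro h
      rw [← h] at e
      refine mul_right_cancel (b := t i * s) ?_
      rw [← e]
      simp only [mul_assoc]
    · intro h
      rw [← h] at e
      refine mul_left_cancel (a := s * t (i + 1)) ?_
      rw [e]
      simp only [mul_assoc]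
  induction i using Int.induction_on with
  | zero => exact h₀
  | succ n ih => exact (hbr _).1 ih
  | pred n ih => exact (hbr _).2 (by rwa [sub_add_cancel])

/-- The family with `t 0 = x`, `t 1 = y` and `t (i + 1) * t i` constant. -/
def dualSeq {G : Type*} [Group G] (x y : G) (i : ℤ) : G :=
  (y * x) ^ (i / 2) * (if i % 2 = 0 then x else y) * ((y * x) ^ (i / 2))⁻¹

theorem dualSeq_zero {G : Type*} [Group G] (x y : G) : dualSeq x y 0 = x := by simp [dualSeq]

theorem dualSeq_one {G : Type*} [Group G] (x y : G) : dualSeq x y 1 = y := by simp [dualSeq]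

theorem dualSeq_mul {G : Type*} [Group G] (x y : G) (i : ℤ) :
    dualSeq x y (i + 1) * dualSeq x y i = y * x := by
  unfold dualSeq
  have comm : ∀ k : ℤ, (y * x) ^ k * (y * x) * ((y * x) ^ k)⁻¹ = y * x := fun k => by
    rw [← zpow_add_one, add_comm, zpow_add, zpow_one, mul_inv_cancel_right]
  rcases Int.emod_two_eq_zero_or_one i with h | h
  · rw [if_neg (by omega), if_pos h, show (i + 1) / 2 = i / 2 by omega]
    refine Eq.trans ?_ (comm (i / 2))
    generalize (y * x) ^ (i / 2) = D
    group
  · rw [if_pos (by omega), if_neg (by omega), show (i + 1) / 2 = i / 2 + 1 by omega]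
    rw [zpow_add_one]
    refine Eq.trans ?_ (comm (i / 2))
    generalize (y * x) ^ (i / 2) = D
    group

theorem eq_of_dual {G : Type*} [Group G] {t u : ℤ → G}
    (h : ∀ i, t (i + 1) * t i = u (i + 1) * u i) (h₀ : t 0 = u 0) (i : ℤ) : t i = u i := by
  induction i using Int.induction_on with
  | zero => exact h₀
  | succ n ih => have := h n; rw [ih] at this; exact mul_right_cancel this
  | pred n ih =>
    have := h (-n - 1)
    rw [sub_add_cancel, ih] at this
    exact mul_left_cancel this

variable {r : ℕ}

theorem BInf.rel {u v : FreeGroup (ShiGen r)} (h : ShiRel r u v) :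
    PresentedGroup.mk {w : FreeGroup (ShiGen r) | ∃ u v, ShiRel r u v ∧ w = u * v⁻¹} u =
      PresentedGroup.mk _ v :=
  PresentedGroup.mk_eq_mk_of_mul_inv_mem ⟨u, v, h, rfl⟩

theorem commute_dualSeq {G : Type*} [Group G] {x y z : G} (hx : Commute z x) (hy : Commute z y)
    (i : ℤ) : Commute z (dualSeq x y i) := by
  have h : Commute z ((y * x) ^ (i / 2)) := (hy.mul_right hx).zpow_right _
  unfold dualSeq
  refine (h.mul_right ?_).mul_right h.inv_right
  split_ifs
  · exact hx
  · exact hy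

/-- The homomorphism `B⁺(∞,∞,r) → B(∞,∞,r)`. -/
def toBInf (r : ℕ) : BInfPos r →* BInf r :=
  PresentedMonoid.lift
    (fun
      | .t i => dualSeq (BInf.gen (.t 0)) (BInf.gen (.t 1)) i
      | .s j => BInf.gen (.s j))
    fun u v h => by
      cases h with
      | comm_s i j h => exact BInf.rel (ShiRel.comm_s i j h)
      | braid_s i j h => exact BInf.rel (ShiRel.braid_s i j h)
      | dual i j =>
        have h : ∀ i, dualSeq (BInf.gen (r := r) (.t 0)) (BInf.gen (.t 1)) i *
            dualSeq (BInf.gen (.t 0)) (BInf.gen (.t 1)) (i - 1) =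
            BInf.gen (.t 1) * BInf.gen (.t 0) := fun i => by
          have := dualSeq_mul (BInf.gen (r := r) (.t 0)) (BInf.gen (.t 1)) (i - 1)
          rwa [sub_add_cancel] at this
        exact (h i).trans (h j).symm
      | braid_t i j h =>
        refine braid_of_conj (dualSeq_mul _ _) (BInf.rel (ShiRel.double j h)) ?_ ?_ i
        · rw [dualSeq_zero]; exact BInf.rel (ShiRel.braid_t 0 j h)
        · rw [dualSeq_one]; exact BInf.rel (ShiRel.braid_t 1 j h)
      | comm_t i j h =>
        exact commute_dualSeq (x := BInf.gen (.t 0)) (y := BInf.gen (.t 1)) (z := BInf.gen (.s j))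
          (BInf.rel (ShiRel.comm_t 0 j h)) (BInf.rel (ShiRel.comm_t 1 j h)) i

theorem toBInf_t (i : ℤ) : toBInf r (BInfPos.t i) =
    dualSeq (BInf.gen (.t 0)) (BInf.gen (.t 1)) i := rfl

theorem toBInf_s (j : Set.Icc 3 r) : toBInf r (BInfPos.s j) = BInf.gen (.s j) := rfl

theorem toBInf_t_fin (i : Fin 2) : toBInf r (BInfPos.t i.1) = BInf.gen (.t i) := by
  fin_cases i <;> simp [toBInf_t, dualSeq]

/-- The images of t₀, t₁ and the s_j in an Ore group G of the monoid satisfy Shi's relations, which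
gives a homomorphism from `BInf r` to G. The embedding of the monoid in G factors through it. -/
theorem toBInf_injective (hr : 2 ≤ r) : Function.Injective (toBInf r) := by
  obtain ⟨G, _, f, hf⟩ := exists_injective_to_group (M := BInfPos r) pos_left_cancel
    pos_right_cancel (pos_ore_left hr)
  let gens : ShiGen r → G := fun
    | .t i => f (BInfPos.t i.1)
    | .s j => f (BInfPos.s j)
  have hrel : ∀ u v, ShiRel r u v → FreeGroup.lift gens u = FreeGroup.lift gens v := by
    intro u v h
    cases h with
    | comm_s i j h =>
      simpa [gens] using congrArg f (BInfPos.comm_s h)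
    | braid_s i j h =>
      simpa [gens] using congrArg f (BInfPos.braid_s h)
    | braid_t i j h => simpa [gens] using congrArg f (BInfPos.braid_t h i.1)
    | comm_t i j h => simpa [gens] using congrArg f (BInfPos.comm_t h i.1)
    | double j h =>
      simpa [gens] using congrArg f
        (dual_double (BInfPos.dual (r := r)) (BInfPos.braid_t h)).symm
  let φ : BInf r →* G := PresentedGroup.toGroup (f := gens) (by
    rintro _ ⟨u, v, h, rfl⟩
    rw [map_mul, map_inv, hrel u v h, mul_inv_cancel])
  have hφ : ∀ x, φ (BInf.gen x) = gens x := fun x => PresentedGroup.toGroup.of _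
  have hcomp : φ.comp (toBInf r) = f := by
    refine BInfPos.hom_ext (fun i => ?_) (fun j => hφ _)
    have h0 : φ (toBInf r (BInfPos.t 0)) = f (BInfPos.t 0) := by
      have := toBInf_t_fin (r := r) 0
      simp only [Fin.val_zero, Nat.cast_zero] at this
      rw [this, hφ]; rfl
    have h1 : φ (toBInf r (BInfPos.t 1)) = f (BInfPos.t 1) := by
      have := toBInf_t_fin (r := r) 1
      simp only [Fin.val_one, Nat.cast_one] at this
      rw [this, hφ]; rfl
    -- Agreement at t₀ and t₁ propagates to all t_i, because both families have the same constant
    -- product t_{i+1}t_i.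
    refine eq_of_dual (t := fun i => φ (toBInf r (BInfPos.t i))) (u := fun i => f (BInfPos.t i))
      (fun i => ?_) h0 i
    simp only [← map_mul, BInfPos.dual]
    simp only [map_mul, h0, h1]
  intro x y hxy
  refine hf ?_
  rw [← hcomp, MonoidHom.comp_apply, MonoidHom.comp_apply, hxy]

theorem toBInf_isQuasiGarsideStructure (hr : 2 ≤ r) :
    IsQuasiGarsideStructure (toBInf r) (BInfPos.Lam r) where
  quasiGarside := pos_isQuasiGarside hr
  fractions := by
    refine isGroupOfFractions (toBInf_injective hr) (pos_ore_left hr) (pos_ore_right hr) ?_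
    refine top_le_iff.1 ((PresentedGroup.closure_range_of _).symm.le.trans
      (Subgroup.closure_mono ?_))
    rintro _ ⟨x, rfl⟩
    cases x with
    | t i => exact ⟨_, toBInf_t_fin i⟩
    | s j => exact ⟨_, toBInf_s j⟩

end Group

/-- The homomorphism from the braid monoid of type `B_{r-1}` to `B⁺(∞,∞,r)`. -/
def typeBToPos (r : ℕ) : TypeBPos (r - 1) →* BInfPos r :=
  PresentedMonoid.lift (fun i => posGen r (i.1 - 1)) fun u v h => by
    cases h with
    | comm i j h =>
      have h₁ := i.2.1
      have h₂ := j.2.2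
      exact (pos_family r).comm _ _ (by omega) (by omega)
    | braid i j h₁ h =>
      have h₂ := j.2.2
      have := (pos_family r).braid (i.1 - 1) (by omega) (by omega)
      rw [show i.1 - 1 + 1 = j.1 - 1 by omega] at this
      exact this
    | double i j h₁ h₂ =>
      have h₃ := j.2.2
      have := (pos_family r).double (by omega)
      simpa [h₁, h₂, mul_assoc] using this

theorem typeBToPos_b (i : Set.Icc 1 (r - 1)) :
    typeBToPos r (TypeBPos.b i) = posGen r (i.1 - 1) := rfl

theorem typeBToPos_Delta (hr : 2 ≤ r) :
    typeBToPos r (TypeBPos.Delta (r - 1)) = BInfPos.Lam r := by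
  rw [typeB_Delta_eq, Lam_eq hr, map_pow,
    map_cox (typeBToPos r) (γ := posGen r) fun i hi => by rw [typeBGen_eq hi]; rfl]

end ImprimitiveBraid

open Garside ImprimitiveBraid in
theorem mainTheorem3 (r : ℕ) (hr : 2 ≤ r) :
    -- `(B⁺(∞,∞,r), Λ)` is a quasi-Garside structure on `B(∞,∞,r)`
    (∃ ι : BInfPos r →* BInf r,
      ι (BInfPos.t 0) = BInf.gen (.t 0) ∧ ι (BInfPos.t 1) = BInf.gen (.t 1) ∧
      (∀ j, ι (BInfPos.s j) = BInf.gen (.s j)) ∧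
      IsQuasiGarsideStructure ι (BInfPos.Lam r)) ∧
    -- `Λ` is the image under `ψ` of the Garside element of type `B_{r-1}`,
    -- the least common multiple of the generators
    (∃ ψ : TypeBPos (r - 1) →* BInfPos r,
      (∀ i : Set.Icc 1 (r - 1), i.1 = 1 → ψ (TypeBPos.b i) = BInfPos.t 1 * BInfPos.t 0) ∧
      (∀ (i : Set.Icc 1 (r - 1)) (j : Set.Icc 3 r), j.1 = i.1 + 1 →
        ψ (TypeBPos.b i) = BInfPos.s j) ∧
      (TypeBPos.Delta (r - 1)).IsDelta ∧ ψ (TypeBPos.Delta (r - 1)) = BInfPos.Lam r) ∧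
    -- conjugation by `Λ` is the `r`-th power of the diagram automorphism `τ`
    (∃ τ : MulAut (BInfPos r),
      (∀ i, τ (BInfPos.t i) = BInfPos.t (i + 1)) ∧ (∀ j, τ (BInfPos.s j) = BInfPos.s j) ∧
      ∀ g, BInfPos.Lam r * g = (τ ^ r) g * BInfPos.Lam r) := by
  refine ⟨⟨toBInf r, toBInf_t_fin 0, toBInf_t_fin 1, toBInf_s, toBInf_isQuasiGarsideStructure hr⟩,
    ⟨typeBToPos r, fun i hi => ?_, fun i j hij => ?_, typeB_isDelta _, typeBToPos_Delta hr⟩,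
    ⟨diagramAut r, fun i => rfl, fun j => rfl, Lam_mul hr⟩⟩
  · rw [typeBToPos_b, hi, ← posGen_zero]
  · rw [typeBToPos_b, s_eq_posGen, show i.1 - 1 = j.1 - 2 by omega]
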